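/- **Setting.** Consider the plant $x_{k+1}=Ax_k+Bu_k+w_k$, $y_k=Cx_k+v_k$ with $x_k\in\mathbb R^{n_x}$, $u_k\in\mathbb R^{n_u}$, $y_k\in\mathbb R^{n_y}$, where $w_k\sim\mathcal N(0,Q)$, $v_k\sim\mathcal N(0,R)$ are independent over time and of each other, $Q>0$, $R>0$. Put $f(X)=AXA^\top+Q$. The sensor runs a Kalman filter in steady state: $\bar P\ge 0$ satisfies $\bar P=(I-\mathcal KC)f(\bar P)$ with $\mathcal K=f(\bar P)C^\top(Cf(\bar P)C^\top+R)^{-1}$, the state $x_0\sim\mathcal N(0,f(\bar P))$ is independent of the noise, and the sensor's estimate is $\hat x^s_k=z_k+\mathcal K(y_k-Cz_k)$, where $z_0=0$ and $z_{k}=A\hat x^s_{k-1}+Bu_{k-1}$ for $k\geq1$. At each stage $k=0,\dots,K$ ($K\ge 1$), the controller-scheduler chooses $\nu_k\in\{0,1\}$ (transmit $\hat x_k^s$ or not) and, simultaneously and independently, the attacker chooses $a_k\in\{0,1\}$. The packet is received ($\gamma_k=1$) with probability $0$ if $\nu_k=0$, $\lambda$ if $(\nu_k,a_k)=(1,0)$,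 and $\lambda_a$ if $(\nu_k,a_k)=(1,1)$, where $0\le\lambda_a<\lambda\le1$. The controller's estimate is $\hat x_k=\hat x_k^s$ if $\gamma_k=1$ and $\hat x_k=\bar x_k$ otherwise, with $\bar x_0=0$, $\bar x_{k+1}=A\hat x_k+Bu_k$; the holding time is $\tau_k=0$ if $\gamma_k=1$ and $\tau_k=\tau_{k-1}+1$ otherwise, with initial value $\tau_{-1}=0$. The controller-scheduler chooses $\nu_k$, possibly at random, from $\bar x_k,\tau_{k-1}$ and everything it has observed and done before; it then chooses $u_k$, possibly at random, from this information together with $\nu_k,\gamma_k,\gamma_k\hat x_k^s$. The attacker chooses $a_k$, possibly at random, from $\tau_{k-1}$, the past $\gamma_j$ and its own past actions. Given $W\ge0$, $U>0$, a terminal weight $T\ge0$, real prices $c_s,c_a$ and $\eta\in(0,1)$, the controller-scheduler minimizes and the attacker maximizes $$J=\frac1K\Big(\sum_{k=0}^K\eta^k\,\mathbb E\big(x_k^\top Wx_k+u_k^\top Uu_k+c_s\nu_k-c_aa_k\big)+\eta^{K+1}\mathbb E\big(x_{K+1}^\top Tx_{K+1}\big)\Big)\in(-\infty,\infty]$$ ($T=0$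 gives the cost without terminal term). Let $S_{K+1}=T$, $S_k=\eta A^\top S_{k+1}A+W-\eta^2A^\top S_{k+1}B(\eta B^\top S_{k+1}B+U)^{-1}B^\top S_{k+1}A$ and $L_k=-\eta(\eta B^\top S_{k+1}B+U)^{-1}B^\top S_{k+1}A$. Define the dynamic-programming values $J^c_k(\bar x,\tau)$, $J^a_k(\bar x,\tau)$ for $0\le k\le K+1$, $\bar x\in\mathbb R^{n_x}$, $\tau\in\{0,1,2,\dots\}$ by $J^c_{K+1}=J^a_{K+1}=\mathbb E(x_{K+1}^\top Tx_{K+1}\mid\bar x_{K+1}=\bar x,\tau_K=\tau)$ and, with $c_k=x_k^\top Wx_k+u_k^\top Uu_k+c_s\nu_k-c_aa_k$, $$J^c_k=\inf_{\pi^c_k}\sup_{\pi^a_k}\mathbb E\big(c_k+\eta J^c_{k+1}(\bar x_{k+1},\tau_k)\,\big|\,\bar x_k=\bar x,\tau_{k-1}=\tau\big),$$ $$J^a_k=\sup_{\pi^a_k}\inf_{\pi^c_k}\mathbb E\big(c_k+\eta J^a_{k+1}(\bar x_{k+1},\tau_k)\,\big|\,\bar x_k=\bar x,\tau_{k-1}=\tau\big),$$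 where $\pi^c_k$ ranges over the pairs of a transmission probability and a (possibly randomized) rule giving $u_k$ from $\nu_k,\gamma_k,\gamma_k\hat x^s_k$, and $\pi^a_k$ over the attack probabilities. **Theorem.** (1) There are functions $p_k(\tau),q_k(\tau)\in[0,1]$ such that the following strategies form a Nash equilibrium of the game, among all strategies described above: $\mathbb P(\nu_k=1)=p_k(\tau_{k-1})$ and $u_k=L_k\hat x_k$ for the controller-scheduler, $\mathbb P(a_k=1)=q_k(\tau_{k-1})$ for the attacker. In particular the equilibrium scheduling command depends only on the holding time $\tau_{k-1}$ (and $k$), not on the state estimate, and the gain $L_k$ does not depend on the packet-arrival process. The cost at this equilibrium is finite, equals both $\inf\sup J$ and $\sup\inf J$ over all strategies, and equals $\frac1KJ^c_0(0,0)$. Moreover $J^c_k(\bar x,\tau)=J^a_k(\bar x,\tau)\in\mathbb R$ for all $k,\bar x,\tau$; and for all $k\le K$, $\bar x$, $\tau$ the decision $(p_k(\tau),\,u_k=L_k\hat x_k)$ attains the infimum in $J_k^c(\bar x,\tau)$, and $q_k(\tau)$ attains the supremum in $J^a_k(\bar x,\tau)$. (2) (Separate design of the control.) For every scheduling rule of the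 form $\mathbb P(\nu_k=1)=r_k(\tau_{k-1})$ and every strategy of the attacker, the control law $u_k=L_k\hat x_k$, with the same gains $L_k$, minimizes $J$ among all control laws. -/

import Mathlib

noncomputable section

namespace DoSGame

open MeasureTheory ProbabilityTheory Matrix
open scoped ENNReal unitInterval

/-! ### Vectors, quadratic forms, extended expectation -/

abbrev Vec (n : ℕ) := EuclideanSpace ℝ (Fin n)

/-- The product `M x` of a matrix and a vector. -/
def act {m n : ℕ} (M : Matrix (Fin m) (Fin n) ℝ) (x : Vec n) : Vec m :=
  WithLp.toLp 2 (M *ᵥ x.ofLp)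

/-- The quadratic form `xᵀ M x`. -/
def quad {n : ℕ} (M : Matrix (Fin n) (Fin n) ℝ) (x : Vec n) : ℝ :=
  x.ofLp ⬝ᵥ (M *ᵥ x.ofLp)

/-- The expectation `E f = E f⁺ - E f⁻` as an extended real number. (A function of infinite
positive part and integrable negative part has expectation `⊤`.) -/
def eexp {Ω : Type*} [MeasurableSpace Ω] (μ : Measure Ω) (f : Ω → EReal) : EReal :=
  ((∫⁻ ω, (f ω).toENNReal ∂μ : ℝ≥0∞) : EReal) - ((∫⁻ ω, (- f ω).toENNReal ∂μ : ℝ≥0∞) : EReal)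

/-! ### Data of the game -/

/-- The data: plant `x' = A x + B u + w`, `y = C x + v` with noise covariances `Q`, `R`;
the steady-state error covariance `P` of the Kalman filter; the stage weights `W`, `U`, the terminal
weight `T`, the discount factor `η`, the prices `cs`, `ca` of a transmission and of an attack;
the probabilities `lam`, `lamA` of a successful transmission without and with an attack;
the last stage `K`. -/
structure Model (nx nu ny : ℕ) where
  A : Matrix (Fin nx) (Fin nx) ℝ
  B : Matrix (Fin nx) (Fin nu) ℝ
  C : Matrix (Fin ny) (Fin nx) ℝ
  Q : Matrix (Fin nx) (Fin nx) ℝ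
  R : Matrix (Fin ny) (Fin ny) ℝ
  P : Matrix (Fin nx) (Fin nx) ℝ
  W : Matrix (Fin nx) (Fin nx) ℝ
  U : Matrix (Fin nu) (Fin nu) ℝ
  T : Matrix (Fin nx) (Fin nx) ℝ
  η : ℝ
  cs : ℝ
  ca : ℝ
  lam : I
  lamA : I
  K : ℕ

/-- The Riccati recursion, `j` steps backwards from the terminal weight `T`. -/
def riccati {nx nu : ℕ} (A : Matrix (Fin nx) (Fin nx) ℝ) (B : Matrix (Fin nx) (Fin nu) ℝ)
    (W : Matrix (Fin nx) (Fin nx) ℝ) (U : Matrix (Fin nu) (Fin nu) ℝ)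
    (T : Matrix (Fin nx) (Fin nx) ℝ) (η : ℝ) : ℕ → Matrix (Fin nx) (Fin nx) ℝ
  | 0 => T
  | j + 1 =>
    η • (Aᵀ * riccati A B W U T η j * A) + W
      - η ^ 2 • (Aᵀ * riccati A B W U T η j * B
          * (η • (Bᵀ * riccati A B W U T η j * B) + U)⁻¹ * Bᵀ * riccati A B W U T η j * A)

/-- The feedback gain `-η (η Bᵀ S B + U)⁻¹ Bᵀ S A` at stage `k` of a horizon with last stage `K`,
where `S = S_{k+1}` is the Riccati matrix `K - k` steps before the terminal weight. -/
def feedbackGain {nx nu : ℕ} (A : Matrix (Fin nx) (Fin nx) ℝ) (B : Matrix (Fin nx) (Fin nu) ℝ)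
    (W : Matrix (Fin nx) (Fin nx) ℝ) (U : Matrix (Fin nu) (Fin nu) ℝ)
    (T : Matrix (Fin nx) (Fin nx) ℝ) (η : ℝ) (K k : ℕ) : Matrix (Fin nu) (Fin nx) ℝ :=
  -(η • ((η • (Bᵀ * riccati A B W U T η (K - k) * B) + U)⁻¹
      * Bᵀ * riccati A B W U T η (K - k) * A))

/-! ### Strategies -/

/-- What the controller remembers of a past stage `j`: the prediction `x̄_j`, the holding time
`τ_{j-1}`, its command `ν_j`, the acknowledgment `γ_j`, the received `γ_j x̂ˢ_j`, its input `u_j`. -/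
abbrev CRec (nx nu : ℕ) := Vec nx × ℕ × Bool × Bool × Vec nx × Vec nu

/-- What the attacker remembers of a past stage `j`: `τ_{j-1}`, its action `a_j`, and `γ_j`. -/
abbrev ARec := ℕ × Bool × Bool

/-- A control rule within one stage: a measurable map from `ν`, `γ`, the received vector and a
private uniform seed to the input. -/
structure CtrlRule (nx nu : ℕ) where
  toFun : Bool → Bool → Vec nx → I → Vec nu
  meas : Measurable fun z : Bool × Bool × Vec nx × I => toFun z.1 z.2.1 z.2.2.1 z.2.2.2

/-- A behaviour strategy of the controller-scheduler. At stage `k` it knows its records of the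
stages `< k`, the prediction `x̄_k` and the holding time `τ_{k-1}`; `sched` is the probability of
`ν_k = 1`; `ctrl` gives the input from this information together with `ν_k`, `γ_k`, the
received vector `γ_k x̂ˢ_k` and a private uniform seed. -/
structure Controller (nx nu : ℕ) where
  sched : (k : ℕ) → (Fin k → CRec nx nu) → Vec nx → ℕ → I
  ctrl : (k : ℕ) → (Fin k → CRec nx nu) → Vec nx → ℕ → Bool → Bool → Vec nx → I → Vec nu
  sched_meas : ∀ k, Measurable fun z : (Fin k → CRec nx nu) × Vec nx × ℕ =>
    sched k z.1 z.2.1 z.2.2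
  ctrl_meas : ∀ k, Measurable
    fun z : (Fin k → CRec nx nu) × Vec nx × ℕ × Bool × Bool × Vec nx × I =>
      ctrl k z.1 z.2.1 z.2.2.1 z.2.2.2.1 z.2.2.2.2.1 z.2.2.2.2.2.1 z.2.2.2.2.2.2

/-- A behaviour strategy of the attacker: the probability of `a_k = 1`, from its records of the
stages `< k` and the holding time `τ_{k-1}`. (Its information ranges over a countable set.) -/
structure Attacker where
  prob : (k : ℕ) → (Fin k → ARec) → ℕ → I

lemma measurable_act {m n : ℕ} (M : Matrix (Fin m) (Fin n) ℝ) : Measurable (act M) := by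
  have h : Continuous (act M) :=
    (PiLp.continuous_toLp 2 _).comp
      ((Continuous.matrix_mulVec continuous_const continuous_id).comp (PiLp.continuous_ofLp 2 _))
  exact h.measurable

/-- The estimate `x̂_k`: the received vector if there is one, the prediction `x̄_k` otherwise. -/
def estimate {nx : ℕ} (xbar : Vec nx) (γ : Bool) (recv : Vec nx) : Vec nx :=
  if γ then recv else xbar

/-- Schedule with probability `p k τ_{k-1}` and apply the input `u_k = L k x̂_k`. -/
def markovController {nx nu : ℕ} (p : ℕ → ℕ → I) (L : ℕ → Matrix (Fin nu) (Fin nx) ℝ) :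
    Controller nx nu where
  sched k _ _ τ := p k τ
  ctrl k _ xbar _ _ γ recv _ := act (L k) (estimate xbar γ recv)
  sched_meas k := (measurable_of_countable (p k)).comp (measurable_snd.comp measurable_snd)
  ctrl_meas k := by
    refine (measurable_act (L k)).comp ?_
    unfold estimate
    refine Measurable.ite ?_ (by fun_prop) (by fun_prop)
    exact measurableSet_eq_fun (by fun_prop) measurable_const

/-- Attack with probability `q k τ_{k-1}`. -/
def markovAttacker (q : ℕ → ℕ → I) : Attacker where
  prob k _ τ := q k τ

/-- The linear control rule `u = L x̂` in a stage with prediction `xbar`. -/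
def linearRule {nx nu : ℕ} (L : Matrix (Fin nu) (Fin nx) ℝ) (xbar : Vec nx) : CtrlRule nx nu where
  toFun _ γ recv _ := act L (estimate xbar γ recv)
  meas := by
    refine (measurable_act L).comp ?_
    unfold estimate
    refine Measurable.ite ?_ (by fun_prop) (by fun_prop)
    exact measurableSet_eq_fun (by fun_prop) measurable_const

/-! ### One stage -/

/-- Private seeds of one stage, independent and uniform on `[0,1]`: for `ν`, for `a`, for the
channel, for the input. -/
abbrev Seeds := I × I × I × I

/-- The actions and the channel outcome of one stage, the received vector `γ x̂ˢ`, the estimate. -/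
structure Outcome (nx nu : ℕ) where
  ν : Bool
  a : Bool
  γ : Bool
  recv : Vec nx
  xhat : Vec nx
  u : Vec nu

namespace Model

variable {nx nu ny : ℕ} (G : Model nx nu ny)

/-- One stage, when the scheduler transmits with probability `p`, the attacker attacks with
probability `q`, the input follows `κ`, the sensor's estimate is `xs` and the controller's
prediction is `xbar`. Given `(ν, a)`, the packet arrives with probability `0` if `ν = 0`, `lam` if
`(ν, a) = (1, 0)`, and `lamA` if `(ν, a) = (1, 1)`. -/
def stage (p q : I) (κ : Bool → Bool → Vec nx → I → Vec nu) (xs xbar : Vec nx) (θ : Seeds) :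
    Outcome nx nu :=
  let ν : Bool := decide (θ.1 < p)
  let a : Bool := decide (θ.2.1 < q)
  let γ : Bool := ν && decide (θ.2.2.1 < if a then G.lamA else G.lam)
  let recv : Vec nx := if γ then xs else 0
  { ν := ν
    a := a
    γ := γ
    recv := recv
    xhat := estimate xbar γ recv
    u := κ ν γ recv θ.2.2.2 }

/-- The stage cost `xᵀ W x + uᵀ U u + cs ν - ca a`. -/
def cost (x : Vec nx) (o : Outcome nx nu) : ℝ :=
  quad G.W x + quad G.U o.u + G.cs * (if o.ν then 1 else 0) - G.ca * (if o.a then 1 else 0)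

/-- The next prediction `x̄ = A x̂ + B u`. -/
def nextPred (o : Outcome nx nu) : Vec nx := act G.A o.xhat + act G.B o.u

/-- The next holding time. -/
def nextHold (τ : ℕ) (o : Outcome nx nu) : ℕ := if o.γ then 0 else τ + 1

/-! ### Sensor -/

/-- `f X = A X Aᵀ + Q`. -/
def f (X : Matrix (Fin nx) (Fin nx) ℝ) : Matrix (Fin nx) (Fin nx) ℝ := G.A * X * G.Aᵀ + G.Q

/-- The steady-state Kalman gain. -/
def kalmanGain : Matrix (Fin nx) (Fin ny) ℝ :=
  G.f G.P * G.Cᵀ * (G.C * G.f G.P * G.Cᵀ + G.R)⁻¹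

/-- `P` is a steady-state error covariance of the Kalman filter: a positive semidefinite fixed point
of the covariance recursion. -/
def IsSteadyState : Prop :=
  G.P.PosSemidef ∧ G.P = (1 - G.kalmanGain * G.C) * G.f G.P

/-! ### The play of the game -/

/-- The noise of one stage: `w_k`, `v_k`, and the seeds. -/
abbrev Noise (nx ny : ℕ) := Vec nx × Vec ny × Seeds

/-- The law of the noise of one stage: independent `N(0,Q)`, `N(0,R)` and uniform variables. -/
def noiseLaw : Measure (Noise nx ny) :=
  (multivariateGaussian 0 G.Q).prod ((multivariateGaussian 0 G.R).prod volume)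

/-- A sample point: the initial state `x_0` and the noise of all stages. -/
abbrev Sample (nx ny : ℕ) := Vec nx × (ℕ → Noise nx ny)

/-- `x_0` is a zero-mean Gaussian vector, independent of the i.i.d. noise. Its covariance is
`A P Aᵀ + Q`, the one for which the Kalman filter is in its steady state from stage `0` on. -/
def law : Measure (Sample nx ny) :=
  (multivariateGaussian 0 (G.f G.P)).prod (Measure.infinitePi fun _ : ℕ => G.noiseLaw)

/-- The situation at the beginning of stage `k`: the state `x_k`, the sensor's
prediction `A x̂ˢ_{k-1} + B u_{k-1}`, the controller's prediction `x̄_k = A x̂_{k-1} + B u_{k-1}`, the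
holding time `τ_{k-1}`, and the records of both players. -/
structure Snapshot (nx nu k : ℕ) where
  x : Vec nx
  pred : Vec nx
  xbar : Vec nx
  τ : ℕ
  crec : Fin k → CRec nx nu
  arec : Fin k → ARec

/-- The sensor's estimate `x̂ˢ_k`, from its prediction and the measurement `y_k = C x_k + v_k`. -/
def sensorEstimate (x pred : Vec nx) (v : Vec ny) : Vec nx :=
  pred + act G.kalmanGain ((act G.C x + v) - act G.C pred)

/-- What happens in stage `k`. -/
def snapOutcome (π : Controller nx nu) (ρ : Attacker) {k : ℕ} (s : Snapshot nx nu k)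
    (n : Noise nx ny) : Outcome nx nu :=
  G.stage (π.sched k s.crec s.xbar s.τ) (ρ.prob k s.arec s.τ) (π.ctrl k s.crec s.xbar s.τ)
    (G.sensorEstimate s.x s.pred n.2.1) s.xbar n.2.2

/-- The play: the situation at the beginning of each stage. At the beginning both predictions are
the mean `0` of `x_0`, and the holding time is `0`. -/
def play (π : Controller nx nu) (ρ : Attacker) (ω : Sample nx ny) : (k : ℕ) → Snapshot nx nu k
  | 0 => { x := ω.1, pred := 0, xbar := 0, τ := 0, crec := Fin.elim0, arec := Fin.elim0 }
  | k + 1 =>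
    let s := play π ρ ω k
    let n := ω.2 k
    let o := G.snapOutcome π ρ s n
    { x := act G.A s.x + act G.B o.u + n.1
      pred := act G.A (G.sensorEstimate s.x s.pred n.2.1) + act G.B o.u
      xbar := G.nextPred o
      τ := nextHold s.τ o
      crec := Fin.snoc (α := fun _ => CRec nx nu) s.crec (s.xbar, s.τ, o.ν, o.γ, o.recv, o.u)
      arec := Fin.snoc (α := fun _ => ARec) s.arec (s.τ, o.a, o.γ) }

/-- The realized cost
`K⁻¹ (∑_{k=0}^K η^k (x_kᵀ W x_k + u_kᵀ U u_k + cs ν_k - ca a_k) + η^{K+1} x_{K+1}ᵀ T x_{K+1})`. -/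
def realizedCost (π : Controller nx nu) (ρ : Attacker) (ω : Sample nx ny) : ℝ :=
  (G.K : ℝ)⁻¹ *
    (∑ k ∈ Finset.range (G.K + 1),
        G.η ^ k * G.cost (G.play π ρ ω k).x (G.snapOutcome π ρ (G.play π ρ ω k) (ω.2 k))
      + G.η ^ (G.K + 1) * quad G.T (G.play π ρ ω (G.K + 1)).x)

/-- The expected cost `J`, minimized by the controller-scheduler and maximized by the attacker. -/
def J (π : Controller nx nu) (ρ : Attacker) : EReal :=
  eexp G.law fun ω => ((G.realizedCost π ρ ω : ℝ) : EReal)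

/-! ### Dynamic programming -/

/-- One step of the pair (estimation gap `x̂ˢ - x̂`, sensor error `x - x̂ˢ`) along a stage
in which nothing has been received: the state moves, and the sensor filters the new measurement. -/
def propagate (m : Measure (Vec nx × Vec nx)) : Measure (Vec nx × Vec nx) :=
  (m.prod ((multivariateGaussian 0 G.Q).prod (multivariateGaussian 0 G.R))).map fun z =>
    let xm : Vec nx := act G.A z.1.2 + z.2.1
    let innov : Vec ny := act G.C xm + z.2.2
    (act G.A z.1.1 + act G.kalmanGain innov, xm - act G.kalmanGain innov)

/-- The law of `(x̂ˢ_k - x̄_k, x_k - x̂ˢ_k)` when the holding time is `τ_{k-1} = τ`: directly after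
a reception the gap is `0` and the sensor error has law `N(0, P)`; since then, `τ + 1` steps have
passed. -/
def belief (τ : ℕ) : Measure (Vec nx × Vec nx) :=
  G.propagate^[τ + 1] ((Measure.dirac 0).prod (multivariateGaussian 0 G.P))

/-- The expectation of stage cost plus `η` times the cost-to-go `V`, given `x̄_k` and
`τ_{k-1}`, when the stage is played with transmission probability `p`, control rule `κ` and attack
probability `q`. -/
def stageValue (V : Vec nx → ℕ → EReal) (p : I) (κ : CtrlRule nx nu) (q : I)
    (xbar : Vec nx) (τ : ℕ) : EReal :=
  eexp ((G.belief τ).prod (volume : Measure Seeds)) fun z =>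
    let xs : Vec nx := xbar + z.1.1
    let o := G.stage p q κ.toFun xs xbar z.2
    ((G.cost (xs + z.1.2) o : ℝ) : EReal) + (G.η : EReal) * V (G.nextPred o) (nextHold τ o)

/-- The terminal value `E(xᵀ T x)` given the prediction and the holding time. -/
def terminalValue (xbar : Vec nx) (τ : ℕ) : EReal :=
  eexp (G.belief τ) fun z => ((quad G.T (xbar + z.1 + z.2) : ℝ) : EReal)

/-- The min-max recursion, `j` steps backwards from the terminal value. -/
def minMax : ℕ → Vec nx → ℕ → EReal
  | 0 => G.terminalValue
  | j + 1 => fun xbar τ =>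
    ⨅ pκ : I × CtrlRule nx nu, ⨆ q : I, G.stageValue (minMax j) pκ.1 pκ.2 q xbar τ

/-- The max-min recursion, `j` steps backwards from the terminal value. -/
def maxMin : ℕ → Vec nx → ℕ → EReal
  | 0 => G.terminalValue
  | j + 1 => fun xbar τ =>
    ⨆ q : I, ⨅ pκ : I × CtrlRule nx nu, G.stageValue (maxMin j) pκ.1 pκ.2 q xbar τ

/-- The min-max dynamic-programming value of stage `k`. -/
def Jc (k : ℕ) : Vec nx → ℕ → EReal := G.minMax (G.K + 1 - k)

/-- The max-min dynamic-programming value of stage `k`. -/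
def Ja (k : ℕ) : Vec nx → ℕ → EReal := G.maxMin (G.K + 1 - k)

/-- The feedback gain of the game at stage `k`. -/
def gain (k : ℕ) : Matrix (Fin nu) (Fin nx) ℝ :=
  feedbackGain G.A G.B G.W G.U G.T G.η G.K k

end Model

end DoSGame

end

/-!
The expected cost splits into a finite part, which depends on the transmissions, attacks and
arrivals only, and a nonnegative part, which measures how far the inputs are from `u = L x̂`.

*Completion of the square.* With the Riccati matrices `S_k`, the identity `complete_square` writes
`uᵀ U u + η x̄ₖ₊₁ᵀ Sₖ₊₁ x̄ₖ₊₁` as a quadratic form at the estimate `x̂` plus a nonnegative form at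
`u - L x̂`. Summed along the play this telescopes (`sum_lintegral_stage`) once the means of the
quadratic forms at the state and at the estimate are known.

*The law of the errors.* The Kalman filter is in its steady state, so that its correction and its
remaining error are independent, the latter with law `N(0, P)` at every stage
(`map_filter_gaussian`, `exists_belief_eq_prod`). Hence, whatever the strategies are, the pair of
the estimation gap `x̂ˢ - x̄` and the sensor error `x - x̂ˢ` has, given everything that both players
know, the centred Gaussian law `belief τ`, which depends on the holding time only
(`lintegral_hist_errors`): a failed transmission reveals nothing about the errors, and a successful
one closes the gap while the sensor error does not depend on the received vector. Thus a
quadratic form at the state has the mean of its value at `x̄` plus a function of `τ`.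

*Decomposition.* Together these give `J_eq`: `J = ∫ holdCost + excess`, where `holdCost` is bounded
and involves only the holding times, the arrivals and the
transmission and attack actions, and where `excess ∈ [0, ∞]` vanishes for
`u = L x̂`. This holds for arbitrary strategies: all the quadratic terms are nonnegative, so that
they are handled as Lebesgue integrals without any integrability assumption on the inputs.
If the scheduling rule depends on the holding time only, then `holdCost` does not depend on the
control law at all (`holdCost_congr`), which is the separation statement.

*The scheduling game.* What is left is a finite-horizon game whose state is the holding time. Its
stage payoff is affine in each of the two probabilities and therefore has a saddle point
(`exists_saddle_bilinear`). The backward recursion `dpValue` through these saddle points is the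
`τ`-part of both dynamic-programming values, `x̄ᵀ S_k x̄ + dpValue τ` (`minMax_eq`, `maxMin_eq`).
The saddle-point inequalities, summed along the play, show that each player's saddle-point
strategy guarantees the value `dpValue (K + 1) 0 / K` against every strategy of the opponent
(`le_integral_holdCost`, `integral_holdCost_le`). This is the equilibrium.
-/

noncomputable section

namespace DoSGame

open MeasureTheory ProbabilityTheory Matrix
open scoped ENNReal unitInterval

/-! ### Quadratic forms and the Riccati recursion -/

section LinearAlgebra

variable {l m n : ℕ}

lemma act_add (M : Matrix (Fin m) (Fin n) ℝ) (x y : Vec n) : act M (x + y) = act M x + act M y := by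
  simp [act, Matrix.mulVec_add]

lemma act_smul (M : Matrix (Fin m) (Fin n) ℝ) (c : ℝ) (x : Vec n) :
    act M (c • x) = c • act M x := by
  simp [act, Matrix.mulVec_smul]

attribute [fun_prop] measurable_act

/-- The product with a matrix, as a continuous linear map. -/
def actCLM (M : Matrix (Fin m) (Fin n) ℝ) : Vec n →L[ℝ] Vec m :=
  LinearMap.toContinuousLinearMap
    { toFun := act M, map_add' := act_add M, map_smul' := act_smul M }

@[simp] lemma actCLM_apply (M : Matrix (Fin m) (Fin n) ℝ) (x : Vec n) : actCLM M x = act M x := rfl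

lemma act_zero (M : Matrix (Fin m) (Fin n) ℝ) : act M 0 = 0 := (actCLM M).map_zero

lemma act_sub (M : Matrix (Fin m) (Fin n) ℝ) (x y : Vec n) : act M (x - y) = act M x - act M y :=
  (actCLM M).map_sub x y

lemma inner_eq_dotProduct (x y : Vec n) : inner ℝ x y = x.ofLp ⬝ᵥ y.ofLp := by
  rw [PiLp.inner_apply, dotProduct]
  exact Finset.sum_congr rfl fun i _ => by simp [mul_comm]

lemma inner_act (M : Matrix (Fin m) (Fin n) ℝ) (x : Vec m) (y : Vec n) :
    inner ℝ x (act M y) = inner ℝ (act Mᵀ x) y := by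
  simp only [inner_eq_dotProduct, act]
  rw [Matrix.dotProduct_mulVec, Matrix.mulVec_transpose]

lemma act_act (M : Matrix (Fin l) (Fin m) ℝ) (N : Matrix (Fin m) (Fin n) ℝ) (x : Vec n) :
    act M (act N x) = act (M * N) x := by
  simp [act, Matrix.mulVec_mulVec]

lemma quad_eq_inner (M : Matrix (Fin n) (Fin n) ℝ) (x : Vec n) :
    quad M x = inner ℝ x (act M x) := by
  rw [inner_eq_dotProduct]; rfl

lemma quad_zero (M : Matrix (Fin n) (Fin n) ℝ) : quad M 0 = 0 := by simp [quad_eq_inner]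

lemma quad_nonneg {M : Matrix (Fin n) (Fin n) ℝ} (hM : M.PosSemidef) (x : Vec n) :
    0 ≤ quad M x := by
  simpa [quad] using hM.dotProduct_mulVec_nonneg x.ofLp

lemma quad_matrix_add (M N : Matrix (Fin n) (Fin n) ℝ) (x : Vec n) :
    quad (M + N) x = quad M x + quad N x := by
  simp [quad, Matrix.add_mulVec]

lemma quad_matrix_sub (M N : Matrix (Fin n) (Fin n) ℝ) (x : Vec n) :
    quad (M - N) x = quad M x - quad N x := by
  simp [quad, Matrix.sub_mulVec]

lemma quad_matrix_smul (c : ℝ) (M : Matrix (Fin n) (Fin n) ℝ) (x : Vec n) :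
    quad (c • M) x = c * quad M x := by
  simp [quad, Matrix.smul_mulVec]

lemma quad_add {M : Matrix (Fin n) (Fin n) ℝ} (hM : Mᵀ = M) (x y : Vec n) :
    quad M (x + y) = quad M x + 2 * inner ℝ x (act M y) + quad M y := by
  simp only [quad_eq_inner, act_add, inner_add_left, inner_add_right]
  have h : inner ℝ y (act M x) = inner ℝ x (act M y) := by
    rw [inner_act, hM, real_inner_comm]
  rw [h]; ring

lemma quad_act (S : Matrix (Fin m) (Fin m) ℝ) (A : Matrix (Fin m) (Fin n) ℝ) (x : Vec n) :
    quad S (act A x) = quad (Aᵀ * S * A) x := by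
  rw [quad_eq_inner, quad_eq_inner, real_inner_comm, inner_act, act_act, act_act, real_inner_comm]

lemma continuous_quad (M : Matrix (Fin n) (Fin n) ℝ) : Continuous (quad M) := by
  have h : quad M = fun x => inner ℝ x (actCLM M x) := funext fun x => quad_eq_inner M x
  rw [h]
  exact continuous_id.inner (actCLM M).continuous

@[fun_prop]
lemma measurable_quad (M : Matrix (Fin n) (Fin n) ℝ) : Measurable (quad M) :=
  (continuous_quad M).measurable

lemma transpose_eq_of_isHermitian {M : Matrix (Fin n) (Fin n) ℝ} (hM : M.IsHermitian) : Mᵀ = M := by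
  simpa [Matrix.conjTranspose_eq_transpose_of_trivial] using hM.eq

lemma posSemidef_of_quad_nonneg {M : Matrix (Fin n) (Fin n) ℝ} (hM : Mᵀ = M)
    (h : ∀ x, 0 ≤ quad M x) : M.PosSemidef := by
  refine Matrix.PosSemidef.of_dotProduct_mulVec_nonneg ?_ fun x => ?_
  · rwa [Matrix.IsHermitian, Matrix.conjTranspose_eq_transpose_of_trivial]
  · simpa [quad] using h (WithLp.toLp 2 x)

end LinearAlgebra

section Riccati

variable {nx nu : ℕ} (A S W : Matrix (Fin nx) (Fin nx) ℝ) (B : Matrix (Fin nx) (Fin nu) ℝ)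
  (U : Matrix (Fin nu) (Fin nu) ℝ) (η : ℝ)

/-- The weight `η Bᵀ S B + U` of a deviation of the input from the optimal one. -/
def inputWeight : Matrix (Fin nu) (Fin nu) ℝ := η • (Bᵀ * S * B) + U

/-- The optimal gain of a single stage with quadratic cost-to-go `S`. -/
def stageGain : Matrix (Fin nu) (Fin nx) ℝ :=
  -(η • ((η • (Bᵀ * S * B) + U)⁻¹ * Bᵀ * S * A))

/-- The weight of the estimate in the optimal cost of a single stage with quadratic cost-to-go
`S`: the Riccati update without the state weight `W`. -/
def estimateWeight : Matrix (Fin nx) (Fin nx) ℝ :=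
  η • (Aᵀ * S * A) - η ^ 2 • (Aᵀ * S * B * (η • (Bᵀ * S * B) + U)⁻¹ * Bᵀ * S * A)

lemma inputWeight_posDef (hS : S.PosSemidef) (hU : U.PosDef) (hη : 0 ≤ η) :
    (inputWeight S B U η).PosDef := by
  unfold inputWeight
  have h : (Bᵀ * S * B).PosSemidef := by
    simpa [Matrix.conjTranspose_eq_transpose_of_trivial] using hS.conjTranspose_mul_mul_same B
  exact Matrix.PosDef.posSemidef_add (h.smul hη) hU

/-- Completion of the square in the input. -/
lemma complete_square (hS : S.PosSemidef) (hU : U.PosDef) (hη : 0 ≤ η) (x : Vec nx) (u : Vec nu) :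
    quad U u + η * quad S (act A x + act B u)
      = quad (estimateWeight A S B U η) x
        + quad (inputWeight S B U η) (u - act (stageGain A S B U η) x) := by
  have hM := inputWeight_posDef S B U η hS hU hη
  have hMt := transpose_eq_of_isHermitian hM.isHermitian
  have hSt := transpose_eq_of_isHermitian hS.isHermitian
  have hdet : IsUnit (inputWeight S B U η).det := (Matrix.isUnit_iff_isUnit_det _).1 hM.isUnit
  set M := inputWeight S B U η with hMdef
  have hgain : stageGain A S B U η = -(η • (M⁻¹ * (Bᵀ * S * A))) := by
    simp [stageGain, hMdef, inputWeight, Matrix.mul_assoc]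
  have hest : estimateWeight A S B U η
      = η • (Aᵀ * S * A) - η ^ 2 • ((Bᵀ * S * A)ᵀ * M⁻¹ * (Bᵀ * S * A)) := by
    simp only [estimateWeight, hMdef, inputWeight, Matrix.transpose_mul, hSt,
      Matrix.transpose_transpose, Matrix.mul_assoc]
  set N := Bᵀ * S * A with hN
  have hdev : u - act (stageGain A S B U η) x = u + η • act (M⁻¹ * N) x := by
    rw [hgain, sub_eq_add_neg]
    congr 1
    simp [act, Matrix.neg_mulVec, Matrix.smul_mulVec]
  have hcross : inner ℝ (act A x) (act S (act B u)) = inner ℝ u (act N x) := by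
    rw [inner_act, inner_act, act_act, act_act, hSt, real_inner_comm]
  have hcross' : inner ℝ u (act M (act (M⁻¹ * N) x)) = inner ℝ u (act N x) := by
    rw [act_act, ← Matrix.mul_assoc, Matrix.mul_nonsing_inv _ hdet, Matrix.one_mul]
  have hself : quad M (act (M⁻¹ * N) x) = quad (Nᵀ * M⁻¹ * N) x := by
    rw [quad_act, Matrix.transpose_mul, Matrix.transpose_nonsing_inv, hMt]
    congr 1
    rw [Matrix.mul_assoc Nᵀ, Matrix.nonsing_inv_mul _ hdet, Matrix.mul_one, Matrix.mul_assoc]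
  have hU' : quad U u + η * quad S (act B u) = quad M u := by
    rw [hMdef, inputWeight, quad_matrix_add, quad_matrix_smul, quad_act]; ring
  rw [hdev, hest, quad_add hSt, quad_add hMt, quad_matrix_sub, quad_matrix_smul, quad_matrix_smul,
    act_smul, inner_smul_right, hcross, hcross', quad_act S A, ← hself, ← hU']
  have : quad M (η • act (M⁻¹ * N) x) = η ^ 2 * quad M (act (M⁻¹ * N) x) := by
    simp only [quad_eq_inner, act_smul, inner_smul_left, inner_smul_right]
    simp; ring
  rw [this]; ring

lemma estimateWeight_posSemidef (hS : S.PosSemidef) (hU : U.PosDef) (hη : 0 ≤ η) :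
    (estimateWeight A S B U η).PosSemidef := by
  have hM := inputWeight_posDef S B U η hS hU hη
  have hMt := transpose_eq_of_isHermitian hM.isHermitian
  have hSt := transpose_eq_of_isHermitian hS.isHermitian
  refine posSemidef_of_quad_nonneg ?_ fun x => ?_
  · have : (η • (Bᵀ * (S * B)) + U)ᵀ = η • (Bᵀ * (S * B)) + U := by
      simpa only [inputWeight, Matrix.mul_assoc] using hMt
    simp only [estimateWeight, Matrix.transpose_sub, Matrix.transpose_smul, Matrix.transpose_mul,
      hSt, Matrix.transpose_transpose, Matrix.transpose_nonsing_inv, this, Matrix.mul_assoc]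
  -- the value of the form is the cost of the optimal input, a sum of nonnegative terms
  · have h := complete_square A S B U η hS hU hη x (act (stageGain A S B U η) x)
    rw [sub_self, quad_zero, add_zero] at h
    rw [← h]
    exact add_nonneg (quad_nonneg hU.posSemidef _) (mul_nonneg hη (quad_nonneg hS _))

variable (T : Matrix (Fin nx) (Fin nx) ℝ)

lemma riccati_succ (j : ℕ) :
    riccati A B W U T η (j + 1) = W + estimateWeight A (riccati A B W U T η j) B U η := by
  rw [riccati, estimateWeight]; abel

lemma riccati_posSemidef (hW : W.PosSemidef) (hU : U.PosDef) (hT : T.PosSemidef) (hη : 0 ≤ η)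
    (j : ℕ) : (riccati A B W U T η j).PosSemidef := by
  induction j with
  | zero => exact hT
  | succ j ih =>
    rw [riccati_succ]
    exact hW.add (estimateWeight_posSemidef A _ B U η ih hU hη)

end Riccati

/-! ### Saddle points of bilinear payoffs -/

/-- A function on the unit square which is affine in each variable has a saddle point: if the
coefficient of one variable keeps its sign, that player has a dominant choice, and otherwise
each player can make the payoff independent of the other's choice. -/
lemma exists_saddle_bilinear (a b c d : ℝ) :
    ∃ p q : I, ∀ p' q' : I,
      a + b * p + c * q' + d * (p * q') ≤ a + b * p + c * q + d * (p * q) ∧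
      a + b * p + c * q + d * (p * q) ≤ a + b * p' + c * q + d * (p' * q) := by
  have best : ∀ e : ℝ, ∃ q : I, ∀ q' : I, e * q' ≤ e * q := fun e => by
    rcases le_total 0 e with he | he
    · exact ⟨1, fun q' => mul_le_mul_of_nonneg_left q'.2.2 he⟩
    · exact ⟨0, fun q' => mul_le_mul_of_nonpos_left q'.2.1 he⟩
  -- the scheduler has a dominant choice
  have dom_p : ∀ p : I, (∀ p' q' : I, (b + d * q') * p ≤ (b + d * q') * p') →
      ∃ p q : I, ∀ p' q' : I,
      a + b * p + c * q' + d * (p * q') ≤ a + b * p + c * q + d * (p * q) ∧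
      a + b * p + c * q + d * (p * q) ≤ a + b * p' + c * q + d * (p' * q) := fun p hp => by
    obtain ⟨q, hq⟩ := best (c + d * p)
    exact ⟨p, q, fun p' q' => ⟨by linarith [hq q'], by linarith [hp p' q]⟩⟩
  -- the attacker has a dominant choice
  have dom_q : ∀ q : I, (∀ p' q' : I, (c + d * p') * q' ≤ (c + d * p') * q) →
      ∃ p q : I, ∀ p' q' : I,
      a + b * p + c * q' + d * (p * q') ≤ a + b * p + c * q + d * (p * q) ∧
      a + b * p + c * q + d * (p * q) ≤ a + b * p' + c * q + d * (p' * q) := fun q hq => by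
    obtain ⟨p, hp⟩ := best (-(b + d * q))
    exact ⟨p, q, fun p' q' => ⟨by linarith [hq p q'], by linarith [hp p']⟩⟩
  have aff : ∀ (e f : ℝ) (t : I), 0 ≤ e → 0 ≤ e + f → 0 ≤ e + f * t := fun e f t h0 h1 => by
    nlinarith [t.2.1, t.2.2, mul_nonneg h0 (sub_nonneg.2 t.2.2), mul_nonneg h1 t.2.1]
  by_cases hb : 0 ≤ b ∧ 0 ≤ b + d
  · exact dom_p 0 fun p' q' => mul_le_mul_of_nonneg_left p'.2.1 (aff b d q' hb.1 hb.2)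
  by_cases hb' : b ≤ 0 ∧ b + d ≤ 0
  · refine dom_p 1 fun p' q' => mul_le_mul_of_nonpos_left p'.2.2 ?_
    linarith [aff (-b) (-d) q' (by linarith) (by linarith)]
  by_cases hc : 0 ≤ c ∧ 0 ≤ c + d
  · exact dom_q 1 fun p' q' => mul_le_mul_of_nonneg_left q'.2.2 (aff c d p' hc.1 hc.2)
  by_cases hc' : c ≤ 0 ∧ c + d ≤ 0
  · refine dom_q 0 fun p' q' => mul_le_mul_of_nonpos_left q'.2.1 ?_
    linarith [aff (-c) (-d) p' (by linarith) (by linarith)]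
  -- no sign is constant: the root of each coefficient lies in the unit interval
  have root : ∀ e : ℝ, ¬ (0 ≤ e ∧ 0 ≤ e + d) → ¬ (e ≤ 0 ∧ e + d ≤ 0) →
      ∃ t : I, e + d * t = 0 := fun e h h' => by
    have hd : d ≠ 0 := by
      rintro rfl
      rcases le_total 0 e with he | he
      · exact h ⟨he, by linarith⟩
      · exact h' ⟨he, by linarith⟩
    refine ⟨⟨-e / d, ?_⟩, by simp; field_simp; ring⟩
    rcases lt_or_gt_of_ne hd with hd | hd
    · refine ⟨div_nonneg_of_nonpos ?_ hd.le, (div_le_one_of_neg hd).2 ?_⟩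
      · by_contra hlt; exact h' ⟨by linarith, by linarith⟩
      · by_contra hlt; exact h ⟨by linarith, by linarith⟩
    · refine ⟨div_nonneg ?_ hd.le, (div_le_one hd).2 ?_⟩
      · by_contra hlt; exact h ⟨by linarith, by linarith⟩
      · by_contra hlt; exact h' ⟨by linarith, by linarith⟩
  obtain ⟨q, hq⟩ := root b hb hb'
  obtain ⟨p, hp⟩ := root c hc hc'
  refine ⟨p, q, fun p' q' => ⟨le_of_eq ?_, le_of_eq ?_⟩⟩
  · linear_combination (q' - q : ℝ) * hp
  · linear_combination (p - p' : ℝ) * hq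

/-! ### Gaussian laws and the steady-state Kalman filter -/

section Gaussian

variable {m n : ℕ}

lemma charFunDual_multivariateGaussian {S : Matrix (Fin n) (Fin n) ℝ} (hS : S.PosSemidef)
    (L : StrongDual ℝ (Vec n)) (a : Vec n) (hL : ∀ x, L x = inner ℝ a x) :
    charFunDual (multivariateGaussian 0 S) L = Complex.exp (-(quad S a : ℝ) / 2) := by
  have h : (InnerProductSpace.toDual ℝ (Vec n)).symm L = a := by
    rw [LinearIsometryEquiv.symm_apply_eq]
    ext x
    simp [hL]
  rw [← charFun_toDual_symm_eq_charFunDual, h, charFun_multivariateGaussian hS]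
  simp [quad, neg_div]

/-- The law of `A d + w` for independent centred Gaussian vectors `d` and `w`. -/
lemma map_act_add_gaussian (A : Matrix (Fin n) (Fin m) ℝ) {P : Matrix (Fin m) (Fin m) ℝ}
    {Q : Matrix (Fin n) (Fin n) ℝ} (hP : P.PosSemidef) (hQ : Q.PosSemidef)
    (hF : (A * P * Aᵀ + Q).PosSemidef) :
    ((multivariateGaussian 0 P).prod (multivariateGaussian 0 Q)).map
        (fun z : Vec m × Vec n => act A z.1 + z.2)
      = multivariateGaussian 0 (A * P * Aᵀ + Q) := by
  let T : Vec m × Vec n →L[ℝ] Vec n :=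
    actCLM A ∘L ContinuousLinearMap.fst ℝ _ _ + ContinuousLinearMap.snd ℝ _ _
  change Measure.map T _ = _
  refine Measure.ext_of_charFunDual (funext fun L => ?_)
  set s := (InnerProductSpace.toDual ℝ (Vec n)).symm L with hs
  have hL : ∀ x, L x = inner ℝ s x := fun x => by simp [hs]
  rw [charFunDual_map, charFunDual_prod, charFunDual_multivariateGaussian hF L s hL,
    charFunDual_multivariateGaussian hP _ (act Aᵀ s) fun x => by
      simp [T, hL, inner_act],
    charFunDual_multivariateGaussian hQ _ s fun x => by simp [T, hL, act_zero],
    ← Complex.exp_add, quad_matrix_add, quad_act, Matrix.transpose_transpose]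
  congr 1
  push_cast
  ring

/-- Filtering one measurement: if `x` has law `N(0, F)`, `K` is the Kalman gain and
`P = (1 - K C) F`, then the correction `K (C x + v)` and the remaining error
`x - K (C x + v)` are independent centred Gaussian vectors, the latter with covariance `P`. -/
lemma map_filter_gaussian (C : Matrix (Fin m) (Fin n) ℝ) {F P : Matrix (Fin n) (Fin n) ℝ}
    {R : Matrix (Fin m) (Fin m) ℝ} (hF : F.PosSemidef) (hR : R.PosDef) (hP : P.PosSemidef)
    {K : Matrix (Fin n) (Fin m) ℝ} (hK : K = F * Cᵀ * (C * F * Cᵀ + R)⁻¹)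
    (hPK : P = (1 - K * C) * F) :
    ((multivariateGaussian 0 F).prod (multivariateGaussian 0 R)).map
        (fun z : Vec n × Vec m =>
          (act K (act C z.1 + z.2), z.1 - act K (act C z.1 + z.2)))
      = (multivariateGaussian 0 (K * (C * F * Cᵀ + R) * Kᵀ)).prod (multivariateGaussian 0 P) := by
  have hFt := transpose_eq_of_isHermitian hF.isHermitian
  have hCFC : (C * F * Cᵀ).PosSemidef := by
    simpa [Matrix.conjTranspose_eq_transpose_of_trivial] using hF.mul_mul_conjTranspose_same C
  have hV : (C * F * Cᵀ + R).PosDef := Matrix.PosDef.posSemidef_add hCFC hR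
  have hVt := transpose_eq_of_isHermitian hV.isHermitian
  have hdet : IsUnit (C * F * Cᵀ + R).det := (Matrix.isUnit_iff_isUnit_det _).1 hV.isUnit
  set V := C * F * Cᵀ + R with hVdef
  have hKV : K * V = F * Cᵀ := by
    rw [hK, Matrix.mul_assoc, Matrix.nonsing_inv_mul _ hdet, Matrix.mul_one]
  have hVK : V * Kᵀ = C * F := by
    have := congrArg Matrix.transpose hKV
    simpa [Matrix.transpose_mul, hVt, hFt] using this
  have hKVK : (K * V * Kᵀ).PosSemidef := by
    simpa [Matrix.conjTranspose_eq_transpose_of_trivial]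
      using hV.posSemidef.mul_mul_conjTranspose_same K
  have hPF : P = F - K * V * Kᵀ := by
    rw [hPK, Matrix.sub_mul, Matrix.one_mul, Matrix.mul_assoc K, Matrix.mul_assoc K, hVK]
  let T₁ : Vec n × Vec m →L[ℝ] Vec n :=
    actCLM K ∘L (actCLM C ∘L ContinuousLinearMap.fst ℝ _ _ + ContinuousLinearMap.snd ℝ _ _)
  let T : Vec n × Vec m →L[ℝ] Vec n × Vec n := T₁.prod (ContinuousLinearMap.fst ℝ _ _ - T₁)
  change Measure.map T _ = _
  refine Measure.ext_of_charFunDual (funext fun L => ?_)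
  set s := (InnerProductSpace.toDual ℝ (Vec n)).symm (L ∘L .inl ℝ _ _) with hs
  set t := (InnerProductSpace.toDual ℝ (Vec n)).symm (L ∘L .inr ℝ _ _) with ht
  have hLs : ∀ x, L (x, 0) = inner ℝ s x := fun x => by simp [hs]
  have hLt : ∀ x, L (0, x) = inner ℝ t x := fun x => by simp [ht]
  have hL : ∀ x y, L (x, y) = inner ℝ s x + inner ℝ t y := fun x y => by
    rw [← hLs, ← hLt, ← map_add]; simp
  set r := act Kᵀ (s - t) with hr
  have hrK : ∀ y, inner ℝ s (act K y) - inner ℝ t (act K y) = inner ℝ r y := fun y => by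
    rw [← inner_sub_left, inner_act]
  rw [charFunDual_map, charFunDual_prod, charFunDual_prod,
    charFunDual_multivariateGaussian hF _ (act Cᵀ r + t) fun x => by
      simp [T, T₁, hL, inner_sub_right, inner_add_left, ← hrK, ← inner_act, act_zero]; ring,
    charFunDual_multivariateGaussian hR.posSemidef _ r fun x => by
      simp [T, T₁, hL, act_zero, ← hrK, ← sub_eq_add_neg],
    charFunDual_multivariateGaussian hKVK _ s fun x => by simp [hL],
    charFunDual_multivariateGaussian hP _ t fun x => by simp [hL],
    ← Complex.exp_add, ← Complex.exp_add]
  congr 1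
  have key : quad F (act Cᵀ r + t) + quad R r = quad (K * V * Kᵀ) s + quad P t := by
    -- both sides are `s, t ↦ quad (K V Kᵀ) s - quad (K V Kᵀ) t + quad F t`
    have h1 : quad F (act Cᵀ r) + quad R r = quad (K * V * Kᵀ) (s - t) := by
      rw [quad_act, ← quad_matrix_add, Matrix.transpose_transpose, ← hVdef, hr, quad_act,
        Matrix.transpose_transpose]
    have h2 : inner ℝ (act Cᵀ r) (act F t) = inner ℝ (s - t) (act (K * V * Kᵀ) t) := by
      rw [hr, ← inner_act, ← inner_act, act_act, act_act, Matrix.mul_assoc K V, hVK,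
        Matrix.mul_assoc K]
    have h3 : quad (K * V * Kᵀ) s
        = quad (K * V * Kᵀ) (s - t) + 2 * inner ℝ (s - t) (act (K * V * Kᵀ) t)
          + quad (K * V * Kᵀ) t := by
      rw [← quad_add (transpose_eq_of_isHermitian hKVK.isHermitian), sub_add_cancel]
    rw [quad_add hFt, h2, hPF, quad_matrix_sub, h3]
    linarith
  have key' := congrArg (fun x : ℝ => (x : ℂ)) key
  push_cast at key' ⊢
  linear_combination (-1 / 2 : ℂ) * key'

end Gaussian

section Centered

variable {E F : Type*} [NormedAddCommGroup E] [NormedSpace ℝ E] [MeasurableSpace E] [BorelSpace E]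
  [NormedAddCommGroup F] [NormedSpace ℝ F] [MeasurableSpace F] [BorelSpace F]

/-- A measure all of whose continuous linear functionals have mean zero. -/
def Centered (μ : Measure E) : Prop := ∀ L : StrongDual ℝ E, ∫ x, L x ∂μ = 0

lemma Centered.map {μ : Measure E} (h : Centered μ) (T : E →L[ℝ] F) : Centered (μ.map T) := by
  intro L
  rw [integral_map (by fun_prop) (by fun_prop)]
  exact h (L ∘L T)

lemma Centered.prod [SecondCountableTopology E] [SecondCountableTopology F] {μ : Measure E}
    {ν : Measure F} [IsGaussian μ] [IsGaussian ν]
    (hμ : Centered μ) (hν : Centered ν) : Centered (μ.prod ν) := by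
  intro L
  have hL : ∀ z : E × F, L z = (L ∘L .inl ℝ E F) z.1 + (L ∘L .inr ℝ E F) z.2 := fun z => by
    simp [← map_add]
  simp_rw [hL]
  rw [integral_add ((IsGaussian.integrable_dual μ _).comp_fst ν)
    ((IsGaussian.integrable_dual ν _).comp_snd μ), integral_fun_fst, integral_fun_snd, hμ, hν]
  simp

lemma centered_dirac : Centered (Measure.dirac (0 : E)) := fun L => by simp

lemma centered_multivariateGaussian {n : ℕ} (S : Matrix (Fin n) (Fin n) ℝ) :
    Centered (multivariateGaussian 0 S) := fun L => by
  rw [L.integral_comp_comm IsGaussian.integrable_fun_id, integral_id_multivariateGaussian, map_zero]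

lemma integrable_quad {n : ℕ} (μ : Measure E) [IsGaussian μ] (M : Matrix (Fin n) (Fin n) ℝ)
    (ℓ : E →L[ℝ] Vec n) : Integrable (fun z => quad M (ℓ z)) μ := by
  have h : ∀ z, quad M (ℓ z) = ∑ i, (ℓ z) i * (act M (ℓ z)) i := fun z => by
    rw [quad_eq_inner, inner_eq_dotProduct, dotProduct]
  simp_rw [h]
  refine integrable_finsetSum _ fun i _ => ?_
  have h1 := IsGaussian.memLp_dual μ (EuclideanSpace.proj i ∘L ℓ) 2 (by simp)
  have h2 := IsGaussian.memLp_dual μ (EuclideanSpace.proj i ∘L actCLM M ∘L ℓ) 2 (by simp)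
  exact h1.integrable_mul h2

/-- The mean of a positive semidefinite form at `x + ℓ z`, for a centred Gaussian `z`: the linear
term has mean zero. -/
lemma lintegral_quad_add {n : ℕ} (μ : Measure E) [IsGaussian μ] (hμ : Centered μ)
    {M : Matrix (Fin n) (Fin n) ℝ} (hM : M.PosSemidef) (ℓ : E →L[ℝ] Vec n) (x : Vec n) :
    ∫⁻ z, ENNReal.ofReal (quad M (x + ℓ z)) ∂μ
      = ENNReal.ofReal (quad M x + ∫ z, quad M (ℓ z) ∂μ) := by
  have hMt := transpose_eq_of_isHermitian hM.isHermitian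
  let L : StrongDual ℝ E := (2 : ℝ) • (innerSL ℝ x ∘L actCLM M ∘L ℓ)
  have hL : ∀ z, quad M (x + ℓ z) = quad M x + L z + quad M (ℓ z) := fun z => by
    rw [quad_add hMt]; simp [L]
  have hi : Integrable (fun z => quad M x + L z + quad M (ℓ z)) μ :=
    ((integrable_const _).add (IsGaussian.integrable_dual μ L)).add (integrable_quad μ M ℓ)
  rw [← ofReal_integral_eq_lintegral_ofReal]
  · congr 1
    simp_rw [hL]
    rw [integral_add (f := fun z => quad M x + L z)
      ((integrable_const _).add (IsGaussian.integrable_dual μ L))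
      (integrable_quad μ M ℓ), integral_add (integrable_const _)
      (IsGaussian.integrable_dual μ L), hμ L]
    simp
  · simpa only [hL] using hi
  · exact ae_of_all _ fun z => quad_nonneg hM _

end Centered

namespace Model

variable {nx nu ny : ℕ} (G : Model nx nu ny)

/-- One filtering step: the new estimation gap and sensor error, from the old ones and the
noise `(w, v)`. -/
def propagateCLM : (Vec nx × Vec nx) × (Vec nx × Vec ny) →L[ℝ] Vec nx × Vec nx :=
  let xm : (Vec nx × Vec nx) × (Vec nx × Vec ny) →L[ℝ] Vec nx :=
    actCLM G.A ∘L (.snd ℝ _ _) ∘L (.fst ℝ _ _) + (.fst ℝ _ _) ∘L (.snd ℝ _ _)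
  let corr : (Vec nx × Vec nx) × (Vec nx × Vec ny) →L[ℝ] Vec nx :=
    actCLM G.kalmanGain ∘L (actCLM G.C ∘L xm + (.snd ℝ _ _) ∘L (.snd ℝ _ _))
  (actCLM G.A ∘L (.fst ℝ _ _) ∘L (.fst ℝ _ _) + corr).prod (xm - corr)

lemma propagateCLM_apply (z : (Vec nx × Vec nx) × (Vec nx × Vec ny)) :
    G.propagateCLM z
      = (act G.A z.1.1 + act G.kalmanGain (act G.C (act G.A z.1.2 + z.2.1) + z.2.2),
        act G.A z.1.2 + z.2.1 - act G.kalmanGain (act G.C (act G.A z.1.2 + z.2.1) + z.2.2)) := rfl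

lemma propagate_eq_map (m : Measure (Vec nx × Vec nx)) :
    G.propagate m
      = (m.prod ((multivariateGaussian 0 G.Q).prod (multivariateGaussian 0 G.R))).map
          G.propagateCLM := rfl

lemma isGaussian_centered_propagate {m : Measure (Vec nx × Vec nx)} [IsGaussian m]
    (hm : Centered m) : IsGaussian (G.propagate m) ∧ Centered (G.propagate m) := by
  rw [propagate_eq_map]
  exact ⟨inferInstance, (hm.prod ((centered_multivariateGaussian _).prod
    (centered_multivariateGaussian _))).map _⟩

lemma belief_zero : G.belief 0
    = G.propagate ((Measure.dirac 0).prod (multivariateGaussian 0 G.P)) := rfl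

lemma belief_succ (τ : ℕ) : G.belief (τ + 1) = G.propagate (G.belief τ) := by
  rw [belief, Function.iterate_succ_apply', belief]

lemma isGaussian_centered_belief (τ : ℕ) : IsGaussian (G.belief τ) ∧ Centered (G.belief τ) := by
  induction τ with
  | zero =>
    exact G.isGaussian_centered_propagate (centered_dirac.prod (centered_multivariateGaussian _))
  | succ τ ih =>
    have := ih.1
    rw [belief_succ]
    exact G.isGaussian_centered_propagate ih.2

instance isGaussian_belief (τ : ℕ) : IsGaussian (G.belief τ) :=
  (G.isGaussian_centered_belief τ).1

lemma f_posSemidef (hQ : G.Q.PosDef) (hP : G.IsSteadyState) : (G.f G.P).PosSemidef := by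
  have h : (G.A * G.P * G.Aᵀ).PosSemidef := by
    simpa [Matrix.conjTranspose_eq_transpose_of_trivial] using hP.1.mul_mul_conjTranspose_same G.A
  exact h.add hQ.posSemidef

/-- The sensor's prediction error has the stationary law `N(0, A P Aᵀ + Q)`. -/
lemma lintegral_predict (hQ : G.Q.PosDef) (hP : G.IsSteadyState) {ψ : Vec nx → ℝ≥0∞}
    (hψ : Measurable ψ) :
    ∫⁻ d, ∫⁻ w, ψ (act G.A d + w) ∂multivariateGaussian 0 G.Q ∂multivariateGaussian 0 G.P
      = ∫⁻ x, ψ x ∂multivariateGaussian 0 (G.f G.P) := by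
  rw [f, ← map_act_add_gaussian G.A hP.1 hQ.posSemidef (G.f_posSemidef hQ hP),
    lintegral_map hψ (by fun_prop), lintegral_prod _ (by fun_prop)]

/-- The sensor's correction and its remaining error are independent, the latter with law
`N(0, P)`. -/
lemma exists_lintegral_filter (hQ : G.Q.PosDef) (hR : G.R.PosDef) (hP : G.IsSteadyState) :
    ∃ ι : Measure (Vec nx), IsProbabilityMeasure ι ∧ ∀ ψ : Vec nx × Vec nx → ℝ≥0∞, Measurable ψ →
      ∫⁻ x, ∫⁻ v, ψ (act G.kalmanGain (act G.C x + v), x - act G.kalmanGain (act G.C x + v))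
          ∂multivariateGaussian 0 G.R ∂multivariateGaussian 0 (G.f G.P)
        = ∫⁻ i, ∫⁻ d, ψ (i, d) ∂multivariateGaussian 0 G.P ∂ι := by
  have h := map_filter_gaussian G.C (G.f_posSemidef hQ hP) hR hP.1 (K := G.kalmanGain) rfl hP.2
  refine ⟨multivariateGaussian 0
    (G.kalmanGain * (G.C * G.f G.P * G.Cᵀ + G.R) * G.kalmanGainᵀ), inferInstance, fun ψ hψ => ?_⟩
  rw [← lintegral_prod _ hψ.aemeasurable, ← h, lintegral_map hψ (by fun_prop),
    lintegral_prod]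
  fun_prop

/-- The mean after one filtering step, with the state noise and the measurement noise split. -/
lemma lintegral_propagate (m : Measure (Vec nx × Vec nx)) [SFinite m]
    {φ : Vec nx × Vec nx → ℝ≥0∞} (hφ : Measurable φ) :
    ∫⁻ z, φ z ∂G.propagate m
      = ∫⁻ z, ∫⁻ w, ∫⁻ v, φ (G.propagateCLM (z, (w, v))) ∂multivariateGaussian 0 G.R
          ∂multivariateGaussian 0 G.Q ∂m := by
  have hT : Measurable G.propagateCLM := G.propagateCLM.continuous.measurable
  have hφT : Measurable fun z => φ (G.propagateCLM z) := hφ.comp hT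
  rw [propagate_eq_map, lintegral_map hφ hT, lintegral_prod _ hφT.aemeasurable]
  refine lintegral_congr fun z => ?_
  rw [lintegral_prod]
  exact (hφT.comp measurable_prodMk_left).aemeasurable

lemma lintegral_propagate_prod (hQ : G.Q.PosDef) (hP : G.IsSteadyState)
    (μ : Measure (Vec nx)) [SFinite μ] {φ : Vec nx × Vec nx → ℝ≥0∞} (hφ : Measurable φ) :
    ∫⁻ z, φ z ∂G.propagate (μ.prod (multivariateGaussian 0 G.P))
      = ∫⁻ e, ∫⁻ x, ∫⁻ v, φ (act G.A e + act G.kalmanGain (act G.C x + v),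
            x - act G.kalmanGain (act G.C x + v))
          ∂multivariateGaussian 0 G.R ∂multivariateGaussian 0 (G.f G.P) ∂μ := by
  rw [G.lintegral_propagate _ hφ]
  simp only [propagateCLM_apply]
  rw [lintegral_prod]
  · refine lintegral_congr fun e => ?_
    rw [← G.lintegral_predict hQ hP]
    fun_prop
  · refine Measurable.aemeasurable ?_
    fun_prop

/-- In the steady state, the sensor error stays independent of the estimation gap, with law
`N(0, P)`. -/
lemma exists_propagate_eq_prod (hQ : G.Q.PosDef) (hR : G.R.PosDef) (hP : G.IsSteadyState)
    (μ : Measure (Vec nx)) [IsProbabilityMeasure μ] :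
    ∃ μ' : Measure (Vec nx), IsProbabilityMeasure μ' ∧
      G.propagate (μ.prod (multivariateGaussian 0 G.P))
        = μ'.prod (multivariateGaussian 0 G.P) := by
  obtain ⟨ι, hι, hfilter⟩ := G.exists_lintegral_filter hQ hR hP
  have hmap : Measurable fun z : Vec nx × Vec nx => act G.A z.1 + z.2 := by fun_prop
  have hprob := Measure.isProbabilityMeasure_map (μ := μ.prod ι) hmap.aemeasurable
  refine ⟨(μ.prod ι).map fun z => act G.A z.1 + z.2, hprob, ?_⟩
  refine Measure.ext_of_lintegral _ fun φ hφ => ?_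
  rw [G.lintegral_propagate_prod hQ hP μ hφ, lintegral_prod _ hφ.aemeasurable,
    lintegral_map hφ.lintegral_prod_right' hmap, lintegral_prod]
  · refine lintegral_congr fun e => ?_
    rw [hfilter (fun z => φ (act G.A e + z.1, z.2)) (by fun_prop)]
  · exact (hφ.lintegral_prod_right'.comp hmap).aemeasurable

lemma exists_belief_eq_prod (hQ : G.Q.PosDef) (hR : G.R.PosDef) (hP : G.IsSteadyState) (τ : ℕ) :
    ∃ μ : Measure (Vec nx), IsProbabilityMeasure μ ∧
      G.belief τ = μ.prod (multivariateGaussian 0 G.P) := by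
  induction τ with
  | zero => exact G.exists_propagate_eq_prod hQ hR hP _
  | succ τ ih =>
    obtain ⟨μ, hμ, h⟩ := ih
    rw [belief_succ, h]
    exact G.exists_propagate_eq_prod hQ hR hP μ

/-- The initial belief, in terms of the initial state `x_0 ~ N(0, A P Aᵀ + Q)` and the first
measurement. -/
lemma lintegral_belief_zero (hQ : G.Q.PosDef) (hP : G.IsSteadyState)
    {φ : Vec nx × Vec nx → ℝ≥0∞} (hφ : Measurable φ) :
    ∫⁻ z, φ z ∂G.belief 0
      = ∫⁻ x, ∫⁻ v, φ (act G.kalmanGain (act G.C x + v), x - act G.kalmanGain (act G.C x + v))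
        ∂multivariateGaussian 0 G.R ∂multivariateGaussian 0 (G.f G.P) := by
  rw [belief_zero, G.lintegral_propagate_prod hQ hP _ hφ, lintegral_dirac]
  simp [act_zero]

end Model

/-! ### Extended expectations -/

/-- The extended expectation of a nonnegative function plus an integrable one. -/
lemma eexp_coe_add {Ω : Type*} [MeasurableSpace Ω] {μ : Measure Ω} {g b : Ω → ℝ}
    (hg : Measurable g) (hg0 : ∀ ω, 0 ≤ g ω) (hb : Integrable b μ) :
    eexp μ (fun ω => ((g ω + b ω : ℝ) : EReal))
      = ((∫⁻ ω, ENNReal.ofReal (g ω) ∂μ : ℝ≥0∞) : EReal) + ((∫ ω, b ω ∂μ : ℝ) : EReal) := by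
  have hbm : AEMeasurable b μ := hb.aemeasurable
  have hpos : ∫⁻ ω, ENNReal.ofReal (b ω) ∂μ ≠ ⊤ := hb.lintegral_lt_top.ne
  have hneg : ∫⁻ ω, ENNReal.ofReal (-b ω) ∂μ ≠ ⊤ := hb.neg.lintegral_lt_top.ne
  have hneg' : ∫⁻ ω, ENNReal.ofReal (-(g ω + b ω)) ∂μ ≠ ⊤ :=
    ne_top_of_le_ne_top hneg
      (lintegral_mono fun ω => ENNReal.ofReal_le_ofReal (by linarith [hg0 ω]))
  have hpt : ∀ ω, ENNReal.ofReal (g ω + b ω) + ENNReal.ofReal (-b ω)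
      = ENNReal.ofReal (g ω) + ENNReal.ofReal (b ω) + ENNReal.ofReal (-(g ω + b ω)) := fun ω => by
    have e : ∀ x : ℝ, ENNReal.ofReal x = ENNReal.ofReal (max x 0) := fun x => by
      rcases le_total x 0 with h | h <;> simp [h, ENNReal.ofReal_of_nonpos]
    rw [e (g ω + b ω), e (-b ω), e (b ω), e (-(g ω + b ω)),
      ← ENNReal.ofReal_add (by positivity) (by positivity),
      ← ENNReal.ofReal_add (hg0 ω) (by positivity),
      ← ENNReal.ofReal_add (add_nonneg (hg0 ω) (by positivity)) (by positivity)]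
    congr 1
    have e' : ∀ x : ℝ, max x 0 = max (-x) 0 + x := fun x => by
      rcases le_total x 0 with h | h <;> simp [h]
    rw [e' (g ω + b ω), e' (b ω)]
    ring
  have hint := lintegral_congr (μ := μ) hpt
  have hm1 : AEMeasurable (fun ω => ENNReal.ofReal (-b ω)) μ := hbm.neg.ennreal_ofReal
  have hm2 : AEMeasurable (fun ω => ENNReal.ofReal (-(g ω + b ω))) μ :=
    (hg.aemeasurable.add hbm).neg.ennreal_ofReal
  rw [lintegral_add_right' _ hm1, lintegral_add_right' _ hm2,
    lintegral_add_right' _ hbm.ennreal_ofReal] at hint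
  have hE : eexp μ (fun ω => ((g ω + b ω : ℝ) : EReal))
      = ((∫⁻ ω, ENNReal.ofReal (g ω + b ω) ∂μ : ℝ≥0∞) : EReal)
        - ((∫⁻ ω, ENNReal.ofReal (-(g ω + b ω)) ∂μ : ℝ≥0∞) : EReal) := by
    simp only [eexp, ← EReal.coe_neg, EReal.real_coe_toENNReal]
  rw [hE, integral_eq_lintegral_pos_part_sub_lintegral_neg_part hb]
  generalize ∫⁻ ω, ENNReal.ofReal (g ω + b ω) ∂μ = F at *
  generalize ∫⁻ ω, ENNReal.ofReal (-(g ω + b ω)) ∂μ = F' at *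
  generalize ∫⁻ ω, ENNReal.ofReal (g ω) ∂μ = E at *
  generalize ∫⁻ ω, ENNReal.ofReal (b ω) ∂μ = p at *
  generalize ∫⁻ ω, ENNReal.ofReal (-b ω) ∂μ = n at *
  lift F' to NNReal using hneg'
  lift p to NNReal using hpos
  lift n to NNReal using hneg
  have hcoe : ∀ x : NNReal, (((x : ℝ≥0∞) : ℝ≥0∞) : EReal) = ((x : ℝ) : EReal) := fun x => rfl
  induction E with
  | top =>
    have : F = ⊤ := by
      by_contra h
      lift F to NNReal using h
      simp [← ENNReal.coe_add] at hint
    subst this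
    simp only [hcoe, EReal.coe_ennreal_top, EReal.top_sub_coe, EReal.top_add_coe]
  | coe E =>
    have : F ≠ ⊤ := by
      rintro rfl
      simp [← ENNReal.coe_add] at hint
    lift F to NNReal using this
    have h : (F : ℝ) + n = E + p + F' := by exact_mod_cast hint
    simp only [hcoe, ← EReal.coe_sub, ← EReal.coe_add, ENNReal.coe_toReal]
    congr 1
    linarith

/-! ### The coins of one stage -/

/-- The indicator of a Boolean, as a real number. -/
def ind (b : Bool) : ℝ := if b then 1 else 0

lemma ind_nonneg (b : Bool) : 0 ≤ ind b := by cases b <;> simp [ind]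

lemma ind_le_one (b : Bool) : ind b ≤ 1 := by cases b <;> simp [ind]

@[fun_prop]
lemma measurable_ind : Measurable ind := measurable_of_countable _

lemma measurable_decide_lt {α : Type*} [MeasurableSpace α] {f g : α → I} (hf : Measurable f)
    (hg : Measurable g) : Measurable fun x => decide (f x < g x) := by
  refine measurable_to_bool ?_
  convert measurableSet_lt hf hg using 1
  ext x
  simp

lemma integrable_ind {α : Type*} [MeasurableSpace α] {μ : Measure α} [IsFiniteMeasure μ]
    {f : α → Bool} (hf : Measurable f) : Integrable (fun x => ind (f x)) μ := by
  refine Integrable.of_bound (by fun_prop) 1 (ae_of_all _ fun x => ?_)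
  rw [Real.norm_of_nonneg (ind_nonneg _)]
  exact ind_le_one _

lemma integral_ind_lt (p : I) : ∫ t : I, ind (decide (t < p)) = p := by
  have h : (fun t : I => ind (decide (t < p))) = Set.indicator (Set.Iio p) 1 := by
    ext t
    simp [ind, Set.indicator_apply]
  rw [h, integral_indicator_one measurableSet_Iio, Measure.real, unitInterval.volume_Iio,
    ENNReal.toReal_ofReal p.2.1]

namespace Model

variable {nx nu ny : ℕ} (G : Model nx nu ny)

/-- The probability that the packet arrives, when `p` and `q` are the probabilities of a
transmission and of an attack. -/
def arrival (p q : I) : ℝ := p * ((1 - q) * G.lam + q * G.lamA)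

/-- The acknowledgment as a function of the seeds. -/
def ack (p q : I) (θ : Seeds) : Bool :=
  decide (θ.1 < p) && decide (θ.2.2.1 < if decide (θ.2.1 < q) then G.lamA else G.lam)

lemma measurable_ack {α : Type*} [MeasurableSpace α] {p q : α → I} {θ : α → Seeds}
    (hp : Measurable p) (hq : Measurable q) (hθ : Measurable θ) :
    Measurable fun x => G.ack (p x) (q x) (θ x) := by
  have h1 : Measurable fun x => decide ((θ x).1 < p x) := measurable_decide_lt (by fun_prop) hp
  have h2 : Measurable fun x => decide ((θ x).2.1 < q x) := measurable_decide_lt (by fun_prop) hq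
  have h3 : Measurable fun x => decide ((θ x).2.2.1
      < if decide ((θ x).2.1 < q x) then G.lamA else G.lam) :=
    measurable_decide_lt (by fun_prop)
      ((measurable_of_countable fun b : Bool => if b then G.lamA else G.lam).comp h2)
  exact (measurable_of_countable fun b : Bool × Bool => b.1 && b.2).comp (h1.prodMk h3)

lemma integral_ind_transmit (p : I) : ∫ θ : Seeds, ind (decide (θ.1 < p)) = p := by
  rw [Measure.volume_eq_prod, integral_fun_fst (fun t : I => ind (decide (t < p))), integral_ind_lt]
  simp

lemma integral_ind_attack (q : I) : ∫ θ : Seeds, ind (decide (θ.2.1 < q)) = q := by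
  rw [Measure.volume_eq_prod,
    integral_fun_snd (fun t : I × I × I => ind (decide (t.1 < q))), Measure.volume_eq_prod,
    integral_fun_fst (fun t : I => ind (decide (t < q))), integral_ind_lt]
  simp

lemma integral_ind_ack (p q : I) : ∫ θ : Seeds, ind (G.ack p q θ) = G.arrival p q := by
  have hsplit : ∀ θ : Seeds, ind (G.ack p q θ)
      = ind (decide (θ.1 < p)) * (ind (decide (θ.2.1 < q)) * ind (decide (θ.2.2.1 < G.lamA))
        + (1 - ind (decide (θ.2.1 < q))) * ind (decide (θ.2.2.1 < G.lam))) := fun θ => by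
    by_cases h1 : θ.1 < p <;> by_cases h2 : θ.2.1 < q <;> simp [ack, ind, h1, h2]
  have hthird : ∀ r : I, ∫ t : I × I, ind (decide (t.1 < r)) = r := fun r => by
    rw [Measure.volume_eq_prod, integral_fun_fst (fun t : I => ind (decide (t < r))),
      integral_ind_lt]
    simp
  have hm : ∀ r : I, Measurable fun t : I => decide (t < r) := fun r =>
    measurable_decide_lt measurable_id measurable_const
  have hi : ∀ r : I, Integrable fun t : I => ind (decide (t < r)) := fun r => integrable_ind (hm r)
  have hi' : ∀ r : I, Integrable fun t : I × I => ind (decide (t.1 < r)) := fun r =>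
    integrable_ind ((hm r).comp measurable_fst)
  have hone : ∫ t : I, (1 - ind (decide (t < q))) = 1 - q := by
    rw [integral_sub (integrable_const _) (hi q), integral_ind_lt]; simp
  simp_rw [hsplit]
  rw [Measure.volume_eq_prod, integral_prod_mul (fun t : I => ind (decide (t < p)))
    (fun s : I × I × I => ind (decide (s.1 < q)) * ind (decide (s.2.1 < G.lamA))
        + (1 - ind (decide (s.1 < q))) * ind (decide (s.2.1 < G.lam))), integral_ind_lt,
    integral_add, Measure.volume_eq_prod,
    integral_prod_mul (fun t : I => ind (decide (t < q)))
      (fun s : I × I => ind (decide (s.1 < G.lamA))),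
    integral_prod_mul (fun t : I => 1 - ind (decide (t < q)))
      (fun s : I × I => ind (decide (s.1 < G.lam))), hthird, hthird, integral_ind_lt, hone, arrival]
  · ring
  · exact (hi q).mul_prod (hi' G.lamA)
  · exact ((integrable_const _).sub (hi q)).mul_prod (hi' G.lam)

/-! ### The outcome of one stage -/

lemma stage_ν (p q : I) (κ : Bool → Bool → Vec nx → I → Vec nu) (xs xbar : Vec nx) (θ : Seeds) :
    (G.stage p q κ xs xbar θ).ν = decide (θ.1 < p) := rfl

lemma stage_a (p q : I) (κ : Bool → Bool → Vec nx → I → Vec nu) (xs xbar : Vec nx) (θ : Seeds) :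
    (G.stage p q κ xs xbar θ).a = decide (θ.2.1 < q) := rfl

lemma stage_γ (p q : I) (κ : Bool → Bool → Vec nx → I → Vec nu) (xs xbar : Vec nx) (θ : Seeds) :
    (G.stage p q κ xs xbar θ).γ = G.ack p q θ := rfl

lemma stage_recv (p q : I) (κ : Bool → Bool → Vec nx → I → Vec nu) (xs xbar : Vec nx)
    (θ : Seeds) : (G.stage p q κ xs xbar θ).recv = if G.ack p q θ then xs else 0 := rfl

lemma stage_xhat (p q : I) (κ : Bool → Bool → Vec nx → I → Vec nu) (xs xbar : Vec nx)
    (θ : Seeds) : (G.stage p q κ xs xbar θ).xhat = if G.ack p q θ then xs else xbar := by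
  change (if G.ack p q θ then (if G.ack p q θ then xs else 0) else xbar) = _
  cases G.ack p q θ <;> rfl

lemma stage_u (p q : I) (κ : Bool → Bool → Vec nx → I → Vec nu) (xs xbar : Vec nx)
    (θ : Seeds) : (G.stage p q κ xs xbar θ).u = κ (decide (θ.1 < p)) (G.ack p q θ)
      (if G.ack p q θ then xs else 0) θ.2.2.2 := rfl

section Measurability

variable {α : Type*} [MeasurableSpace α] {p q : α → I} {xs xbar : α → Vec nx} {θ : α → Seeds}
  {κ : α → Bool → Bool → Vec nx → I → Vec nu}

lemma measurable_ite_bool {β : Type*} [MeasurableSpace β] {b : α → Bool} {f g : α → β}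
    (hb : Measurable b) (hf : Measurable f) (hg : Measurable g) :
    Measurable fun x => if b x then f x else g x :=
  Measurable.ite (hb (measurableSet_singleton true)) hf hg

lemma measurable_stage_recv (hp : Measurable p) (hq : Measurable q) (hxs : Measurable xs)
    (hθ : Measurable θ) :
    Measurable fun x => (G.stage (p x) (q x) (κ x) (xs x) (xbar x) (θ x)).recv :=
  measurable_ite_bool (G.measurable_ack hp hq hθ) hxs measurable_const

lemma measurable_stage_xhat (hp : Measurable p) (hq : Measurable q) (hxs : Measurable xs)
    (hxbar : Measurable xbar) (hθ : Measurable θ) :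
    Measurable fun x => (G.stage (p x) (q x) (κ x) (xs x) (xbar x) (θ x)).xhat := by
  simp only [stage_xhat]
  exact measurable_ite_bool (G.measurable_ack hp hq hθ) hxs hxbar

lemma measurable_stage_u (hp : Measurable p) (hq : Measurable q) (hxs : Measurable xs)
    (hθ : Measurable θ)
    (hκ : Measurable fun z : α × Bool × Bool × Vec nx × I =>
      κ z.1 z.2.1 z.2.2.1 z.2.2.2.1 z.2.2.2.2) :
    Measurable fun x => (G.stage (p x) (q x) (κ x) (xs x) (xbar x) (θ x)).u := by
  have h1 : Measurable fun x => decide ((θ x).1 < p x) := measurable_decide_lt (by fun_prop) hp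
  have h2 := G.measurable_ack hp hq hθ
  have h3 : Measurable fun x => if G.ack (p x) (q x) (θ x) then xs x else 0 :=
    measurable_ite_bool h2 hxs measurable_const
  have h4 : Measurable fun x => (θ x).2.2.2 := by fun_prop
  exact hκ.comp (measurable_id.prodMk (h1.prodMk (h2.prodMk (h3.prodMk h4))))

end Measurability

/-! ### The value of one stage -/

/-- The mean of the form `M` at the prediction error `(x̂ˢ - x̄) + (x - x̂ˢ)` of the state, for
holding time `τ`. -/
def spread (M : Matrix (Fin nx) (Fin nx) ℝ) (τ : ℕ) : ℝ := ∫ z, quad M (z.1 + z.2) ∂G.belief τ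

/-- The mean of the form `M` at the estimation gap `x̂ˢ - x̄`, for holding time `τ`. -/
def gapSpread (M : Matrix (Fin nx) (Fin nx) ℝ) (τ : ℕ) : ℝ := ∫ z, quad M z.1 ∂G.belief τ

lemma spread_nonneg {M : Matrix (Fin nx) (Fin nx) ℝ} (hM : M.PosSemidef) (τ : ℕ) :
    0 ≤ G.spread M τ := integral_nonneg fun _ => quad_nonneg hM _

lemma gapSpread_nonneg {M : Matrix (Fin nx) (Fin nx) ℝ} (hM : M.PosSemidef) (τ : ℕ) :
    0 ≤ G.gapSpread M τ := integral_nonneg fun _ => quad_nonneg hM _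

lemma lintegral_quad_state {M : Matrix (Fin nx) (Fin nx) ℝ} (hM : M.PosSemidef) (x : Vec nx)
    (τ : ℕ) : ∫⁻ z, ENNReal.ofReal (quad M (x + z.1 + z.2)) ∂G.belief τ
      = ENNReal.ofReal (quad M x + G.spread M τ) := by
  have h := lintegral_quad_add (G.belief τ) (G.isGaussian_centered_belief τ).2
    hM (ContinuousLinearMap.fst ℝ (Vec nx) (Vec nx) + ContinuousLinearMap.snd ℝ _ _) x
  simp only [_root_.add_apply, ContinuousLinearMap.coe_fst',
    ContinuousLinearMap.coe_snd', ← add_assoc] at h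
  exact h

lemma lintegral_quad_gap {M : Matrix (Fin nx) (Fin nx) ℝ} (hM : M.PosSemidef) (x : Vec nx)
    (τ : ℕ) : ∫⁻ z, ENNReal.ofReal (quad M (x + z.1)) ∂G.belief τ
      = ENNReal.ofReal (quad M x + G.gapSpread M τ) := by
  have h := lintegral_quad_add (G.belief τ) (G.isGaussian_centered_belief τ).2
    hM (ContinuousLinearMap.fst ℝ (Vec nx) (Vec nx)) x
  simp only [ContinuousLinearMap.coe_fst'] at h
  exact h

/-- The form `M` at the estimate `x̂`: the gap contributes when the packet arrives. -/
lemma lintegral_quad_estimate {M : Matrix (Fin nx) (Fin nx) ℝ} (hM : M.PosSemidef) (x : Vec nx)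
    (τ : ℕ) (γ : Bool) :
    ∫⁻ z, ENNReal.ofReal (quad M (if γ then x + z.1 else x)) ∂G.belief τ
      = ENNReal.ofReal (quad M x + ind γ * G.gapSpread M τ) := by
  cases γ
  · simp [ind]
  · simpa [ind] using G.lintegral_quad_gap hM x τ

/-- The expected cost of a stage with cost-to-go `xᵀ S x + g τ`, up to the term `xᵀ S' x` of the
Riccati recursion, when the input is the optimal one. -/
def payoff (S : Matrix (Fin nx) (Fin nx) ℝ) (g : ℕ → ℝ) (τ : ℕ) (p q : I) : ℝ :=
  G.spread G.W τ + G.arrival p q * G.gapSpread (estimateWeight G.A S G.B G.U G.η) τ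
    + G.cs * p - G.ca * q + G.η * (G.arrival p q * g 0 + (1 - G.arrival p q) * g (τ + 1))

/-- What the input of a stage costs beyond the optimal linear input, when the cost-to-go has the
quadratic part `S`. -/
def deviation (S : Matrix (Fin nx) (Fin nx) ℝ) (o : Outcome nx nu) : ℝ :=
  quad (inputWeight S G.B G.U G.η) (o.u - act (stageGain G.A S G.B G.U G.η) o.xhat)

lemma deviation_nonneg {S : Matrix (Fin nx) (Fin nx) ℝ} (hS : S.PosSemidef) (hU : G.U.PosDef)
    (hη : 0 ≤ G.η) (o : Outcome nx nu) : 0 ≤ G.deviation S o :=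
  quad_nonneg (inputWeight_posDef S G.B G.U G.η hS hU hη).posSemidef _

lemma nextHold_eq (τ : ℕ) (g : ℕ → ℝ) (o : Outcome nx nu) :
    g (nextHold τ o) = ind o.γ * g 0 + (1 - ind o.γ) * g (τ + 1) := by
  cases h : o.γ <;> simp [nextHold, h, ind]

/-- The stage cost plus a quadratic cost-to-go, after completion of the square. -/
lemma cost_add_quad_nextPred {S : Matrix (Fin nx) (Fin nx) ℝ} (hS : S.PosSemidef)
    (hU : G.U.PosDef) (hη : 0 ≤ G.η) (x : Vec nx) (o : Outcome nx nu) :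
    G.cost x o + G.η * quad S (G.nextPred o)
      = quad G.W x + quad (estimateWeight G.A S G.B G.U G.η) o.xhat + G.deviation S o
        + (G.cs * ind o.ν - G.ca * ind o.a) := by
  have h := complete_square G.A S G.B G.U G.η hS hU hη o.xhat o.u
  simp only [cost, nextPred, deviation, ind]
  linarith

/-- An affine function of the acknowledgment and of the two actions is integrable, and its mean is
the same function of their probabilities. -/
lemma integral_coins (c₀ c₁ c₂ c₃ : ℝ) (p q : I) :
    Integrable (fun θ : Seeds => c₀ + c₁ * ind (G.ack p q θ) + c₂ * ind (decide (θ.1 < p))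
        - c₃ * ind (decide (θ.2.1 < q))) ∧
      ∫ θ : Seeds, (c₀ + c₁ * ind (G.ack p q θ) + c₂ * ind (decide (θ.1 < p))
        - c₃ * ind (decide (θ.2.1 < q)))
      = c₀ + c₁ * G.arrival p q + c₂ * p - c₃ * q := by
  have h1 : Integrable fun θ : Seeds => c₁ * ind (G.ack p q θ) :=
    (integrable_ind (G.measurable_ack measurable_const measurable_const measurable_id)).const_mul _
  have h2 : Integrable fun θ : Seeds => c₂ * ind (decide (θ.1 < p)) :=
    (integrable_ind (measurable_decide_lt measurable_fst measurable_const)).const_mul _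
  have h3 : Integrable fun θ : Seeds => c₃ * ind (decide (θ.2.1 < q)) :=
    (integrable_ind (measurable_decide_lt (by fun_prop) measurable_const)).const_mul _
  have h0 : Integrable fun _ : Seeds => c₀ := integrable_const _
  refine ⟨((h0.add h1).add h2).sub h3, ?_⟩
  rw [integral_sub (f := fun θ : Seeds => c₀ + c₁ * ind (G.ack p q θ)
      + c₂ * ind (decide (θ.1 < p))) ((h0.add h1).add h2) h3,
    integral_add (f := fun θ : Seeds => c₀ + c₁ * ind (G.ack p q θ)) (h0.add h1) h2,
    integral_add h0 h1, integral_const_mul, integral_const_mul, integral_const_mul,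
    integral_ind_ack, integral_ind_transmit, integral_ind_attack]
  simp

/-- The value of a stage with quadratic cost-to-go: the Riccati update, a bilinear payoff of the
two probabilities, and a nonnegative deviation cost of the input. -/
lemma stageValue_eq {S : Matrix (Fin nx) (Fin nx) ℝ} (hS : S.PosSemidef) (hW : G.W.PosSemidef)
    (hU : G.U.PosDef) (hη : 0 ≤ G.η) (g : ℕ → ℝ) (p : I) (κ : CtrlRule nx nu) (q : I)
    (xbar : Vec nx) (τ : ℕ) :
    G.stageValue (fun x t => ((quad S x + g t : ℝ) : EReal)) p κ q xbar τ
      = ((quad (G.W + estimateWeight G.A S G.B G.U G.η) xbar + G.payoff S g τ p q : ℝ) : EReal)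
        + ((∫⁻ z, ENNReal.ofReal (G.deviation S (G.stage p q κ.toFun (xbar + z.1.1) xbar z.2))
            ∂(G.belief τ).prod (volume : Measure Seeds) : ℝ≥0∞) : EReal) := by
  set Z := estimateWeight G.A S G.B G.U G.η with hZdef
  have hZ : Z.PosSemidef := estimateWeight_posSemidef G.A S G.B G.U G.η hS hU hη
  let o : (Vec nx × Vec nx) × Seeds → Outcome nx nu := fun z =>
    G.stage p q κ.toFun (xbar + z.1.1) xbar z.2
  have hxhat : Measurable fun z => (o z).xhat :=
    G.measurable_stage_xhat (p := fun _ => p) (q := fun _ => q) (xbar := fun _ => xbar)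
      measurable_const measurable_const (by fun_prop) measurable_const measurable_snd
  have hu : Measurable fun z => (o z).u :=
    G.measurable_stage_u (p := fun _ => p) (q := fun _ => q) (κ := fun _ => κ.toFun)
      measurable_const measurable_const (by fun_prop) measurable_snd
      (κ.meas.comp measurable_snd)
  have hdev : Measurable fun z => G.deviation S (o z) := by
    unfold deviation
    fun_prop
  have hest_meas : Measurable fun z => quad Z (o z).xhat := (measurable_quad Z).comp hxhat
  have hsplit : ∀ z : (Vec nx × Vec nx) × Seeds,
      G.cost (xbar + z.1.1 + z.1.2) (o z)
        + G.η * (quad S (G.nextPred (o z)) + g (nextHold τ (o z)))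
      = (quad G.W (xbar + z.1.1 + z.1.2) + quad Z (o z).xhat + G.deviation S (o z))
        + (G.η * g (τ + 1) + G.η * (g 0 - g (τ + 1)) * ind (G.ack p q z.2)
          + G.cs * ind (decide (z.2.1 < p)) - G.ca * ind (decide (z.2.2.1 < q))) := fun z => by
    rw [mul_add, ← add_assoc, G.cost_add_quad_nextPred hS hU hη, nextHold_eq _ g]
    simp only [o, stage_γ, stage_ν, stage_a]
    ring
  obtain ⟨hint, hcoins⟩ := G.integral_coins (G.η * g (τ + 1)) (G.η * (g 0 - g (τ + 1)))
    G.cs G.ca p q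
  have hstate : ∫⁻ z, ENNReal.ofReal (quad G.W (xbar + z.1.1 + z.1.2))
      ∂(G.belief τ).prod (volume : Measure Seeds)
        = ENNReal.ofReal (quad G.W xbar + G.spread G.W τ) := by
    rw [lintegral_prod _ (by fun_prop)]
    simp [G.lintegral_quad_state hW]
  have hest : ∫⁻ z, ENNReal.ofReal (quad Z (o z).xhat)
      ∂(G.belief τ).prod (volume : Measure Seeds)
        = ENNReal.ofReal (quad Z xbar + G.arrival p q * G.gapSpread Z τ) := by
    rw [lintegral_prod_symm _ hest_meas.ennreal_ofReal.aemeasurable]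
    simp only [o, stage_xhat, G.lintegral_quad_estimate hZ]
    obtain ⟨h1, h2⟩ := G.integral_coins (quad Z xbar) (G.gapSpread Z τ) 0 0 p q
    simp only [zero_mul, add_zero, sub_zero] at h1 h2
    rw [mul_comm, ← h2, ofReal_integral_eq_lintegral_ofReal h1]
    · simp only [mul_comm]
    · exact ae_of_all _ fun θ => add_nonneg (quad_nonneg hZ _)
        (mul_nonneg (G.gapSpread_nonneg hZ τ) (ind_nonneg _))
  have hreal : ∀ z : (Vec nx × Vec nx) × Seeds,
      ((G.cost (xbar + z.1.1 + z.1.2) (o z) : ℝ) : EReal)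
        + (G.η : EReal) * ((quad S (G.nextPred (o z)) + g (nextHold τ (o z)) : ℝ) : EReal)
      = (((quad G.W (xbar + z.1.1 + z.1.2) + quad Z (o z).xhat + G.deviation S (o z))
        + (G.η * g (τ + 1) + G.η * (g 0 - g (τ + 1)) * ind (G.ack p q z.2)
          + G.cs * ind (decide (z.2.1 < p)) - G.ca * ind (decide (z.2.2.1 < q))) : ℝ) : EReal) :=
    fun z => by rw [← hsplit]; norm_cast
  have hnn := add_nonneg (quad_nonneg hW xbar) (G.spread_nonneg hW τ)
  have hnn' : 0 ≤ quad Z xbar + G.arrival p q * G.gapSpread Z τ := by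
    refine add_nonneg (quad_nonneg hZ xbar) (mul_nonneg ?_ (G.gapSpread_nonneg hZ τ))
    exact mul_nonneg p.2.1 (add_nonneg (mul_nonneg (sub_nonneg.2 q.2.2) G.lam.2.1)
      (mul_nonneg q.2.1 G.lamA.2.1))
  have hdev0 := fun z => G.deviation_nonneg hS hU hη (o z)
  simp only [stageValue]
  rw [show (fun z : (Vec nx × Vec nx) × Seeds =>
      ((G.cost (xbar + z.1.1 + z.1.2) (o z) : ℝ) : EReal)
        + (G.η : EReal) * ((quad S (G.nextPred (o z)) + g (nextHold τ (o z)) : ℝ) : EReal)) = _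
    from funext hreal]
  rw [eexp_coe_add (by fun_prop)
    (fun z => add_nonneg (add_nonneg (quad_nonneg hW _) (quad_nonneg hZ _)) (hdev0 z))
    (hint.comp_snd _), integral_fun_snd (μ := G.belief τ) (fun θ : Seeds => G.η * g (τ + 1)
      + G.η * (g 0 - g (τ + 1)) * ind (G.ack p q θ) + G.cs * ind (decide (θ.1 < p))
      - G.ca * ind (decide (θ.2.1 < q))), hcoins]
  have hsum : ∫⁻ z, ENNReal.ofReal (quad G.W (xbar + z.1.1 + z.1.2) + quad Z (o z).xhat
      + G.deviation S (o z)) ∂(G.belief τ).prod (volume : Measure Seeds)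
      = ENNReal.ofReal (quad G.W xbar + G.spread G.W τ
          + (quad Z xbar + G.arrival p q * G.gapSpread Z τ))
        + ∫⁻ z, ENNReal.ofReal (G.deviation S (o z))
          ∂(G.belief τ).prod (volume : Measure Seeds) := by
    simp_rw [ENNReal.ofReal_add (add_nonneg (quad_nonneg hW _) (quad_nonneg hZ _)) (hdev0 _),
      ENNReal.ofReal_add (quad_nonneg hW _) (quad_nonneg hZ _)]
    rw [lintegral_add_right _ (by fun_prop), lintegral_add_right _ (by fun_prop), hstate, hest,
      ← ENNReal.ofReal_add hnn hnn']
  rw [hsum, EReal.coe_ennreal_add, EReal.coe_ennreal_ofReal, max_eq_left (add_nonneg hnn hnn'),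
    add_right_comm, ← EReal.coe_add]
  congr 2
  simp only [payoff, quad_matrix_add, probReal_univ, one_smul]
  ring

end Model

namespace Model

variable {nx nu ny : ℕ} (G : Model nx nu ny)

/-! ### Dynamic programming -/

lemma exists_saddle_payoff (S : Matrix (Fin nx) (Fin nx) ℝ) (g : ℕ → ℝ) (τ : ℕ) :
    ∃ pq : I × I, ∀ p' q' : I,
      G.payoff S g τ pq.1 q' ≤ G.payoff S g τ pq.1 pq.2 ∧
      G.payoff S g τ pq.1 pq.2 ≤ G.payoff S g τ p' pq.2 := by
  set X := G.gapSpread (estimateWeight G.A S G.B G.U G.η) τ + G.η * (g 0 - g (τ + 1)) with hX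
  have h : ∀ p q : I, G.payoff S g τ p q = (G.spread G.W τ + G.η * g (τ + 1))
      + (G.cs + G.lam * X) * p + (-G.ca) * q + ((G.lamA - G.lam) * X) * (p * q) := fun p q => by
    rw [payoff, arrival, hX]; ring
  obtain ⟨p, q, hpq⟩ := exists_saddle_bilinear (G.spread G.W τ + G.η * g (τ + 1))
    (G.cs + G.lam * X) (-G.ca) ((G.lamA - G.lam) * X)
  exact ⟨(p, q), fun p' q' => by simpa only [h] using hpq p' q'⟩

/-- A saddle point of the payoff of a stage with cost-to-go `xᵀ S x + g τ`. -/
def saddle (S : Matrix (Fin nx) (Fin nx) ℝ) (g : ℕ → ℝ) (τ : ℕ) : I × I :=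
  (G.exists_saddle_payoff S g τ).choose

lemma payoff_saddle_ge (S : Matrix (Fin nx) (Fin nx) ℝ) (g : ℕ → ℝ) (τ : ℕ) (q : I) :
    G.payoff S g τ (G.saddle S g τ).1 q
      ≤ G.payoff S g τ (G.saddle S g τ).1 (G.saddle S g τ).2 :=
  ((G.exists_saddle_payoff S g τ).choose_spec 0 q).1

lemma payoff_saddle_le (S : Matrix (Fin nx) (Fin nx) ℝ) (g : ℕ → ℝ) (τ : ℕ) (p : I) :
    G.payoff S g τ (G.saddle S g τ).1 (G.saddle S g τ).2
      ≤ G.payoff S g τ p (G.saddle S g τ).2 :=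
  ((G.exists_saddle_payoff S g τ).choose_spec p 0).2

/-- The Riccati matrix of the game, `j` steps before the terminal weight. -/
def weight (j : ℕ) : Matrix (Fin nx) (Fin nx) ℝ := riccati G.A G.B G.W G.U G.T G.η j

/-- The part of the dynamic-programming value that depends on the holding time, `j` steps
before the end. -/
def dpValue : ℕ → ℕ → ℝ
  | 0 => G.spread G.T
  | j + 1 => fun τ => G.payoff (G.weight j) (dpValue j) τ
      (G.saddle (G.weight j) (dpValue j) τ).1 (G.saddle (G.weight j) (dpValue j) τ).2

lemma weight_succ (j : ℕ) :
    G.weight (j + 1) = G.W + estimateWeight G.A (G.weight j) G.B G.U G.η :=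
  riccati_succ _ _ _ _ _ _ _

lemma deviation_eq_zero (S : Matrix (Fin nx) (Fin nx) ℝ) {o : Outcome nx nu}
    (h : o.u = act (stageGain G.A S G.B G.U G.η) o.xhat) : G.deviation S o = 0 := by
  rw [deviation, h, sub_self, quad_zero]

variable {G}

lemma weight_posSemidef (hW : G.W.PosSemidef) (hU : G.U.PosDef) (hT : G.T.PosSemidef)
    (hη : 0 ≤ G.η) (j : ℕ) : (G.weight j).PosSemidef :=
  riccati_posSemidef _ _ _ _ _ _ hW hU hT hη j

lemma terminalValue_eq (hT : G.T.PosSemidef) :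
    G.terminalValue = fun x τ => ((quad (G.weight 0) x + G.dpValue 0 τ : ℝ) : EReal) := by
  funext x τ
  have h := eexp_coe_add (μ := G.belief τ) (g := fun z => quad G.T (x + z.1 + z.2)) (b := 0)
    (by fun_prop) (fun z => quad_nonneg hT _) (integrable_zero _ _ _)
  simp only [Pi.zero_apply, add_zero, integral_zero, EReal.coe_zero] at h
  rw [terminalValue, h, G.lintegral_quad_state hT, EReal.coe_ennreal_ofReal,
    max_eq_left (add_nonneg (quad_nonneg hT _) (G.spread_nonneg hT _))]
  rfl

/-- Against the attack probability of the saddle point, no decision of the controller-scheduler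
does better than the dynamic-programming value. -/
lemma le_stageValue_saddle (hW : G.W.PosSemidef) (hU : G.U.PosDef) (hT : G.T.PosSemidef)
    (hη : 0 ≤ G.η) (j : ℕ) (p : I) (κ : CtrlRule nx nu) (x : Vec nx) (τ : ℕ) :
    ((quad (G.weight (j + 1)) x + G.dpValue (j + 1) τ : ℝ) : EReal)
      ≤ G.stageValue (fun x t => ((quad (G.weight j) x + G.dpValue j t : ℝ) : EReal)) p κ
        (G.saddle (G.weight j) (G.dpValue j) τ).2 x τ := by
  rw [stageValue_eq G (weight_posSemidef hW hU hT hη j) hW hU hη, ← weight_succ]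
  refine le_add_of_le_of_nonneg (EReal.coe_le_coe_iff.2 ?_) (EReal.coe_ennreal_nonneg _)
  have h := G.payoff_saddle_le (G.weight j) (G.dpValue j) τ p
  simp only [dpValue]
  linarith

/-- Against the saddle-point transmission probability and the linear input, no attack achieves
more than the dynamic-programming value. -/
lemma stageValue_saddle_le (hW : G.W.PosSemidef) (hU : G.U.PosDef) (hT : G.T.PosSemidef)
    (hη : 0 ≤ G.η) (j : ℕ) (q : I) (x : Vec nx) (τ : ℕ) :
    G.stageValue (fun x t => ((quad (G.weight j) x + G.dpValue j t : ℝ) : EReal))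
        (G.saddle (G.weight j) (G.dpValue j) τ).1
        (linearRule (stageGain G.A (G.weight j) G.B G.U G.η) x) q x τ
      ≤ ((quad (G.weight (j + 1)) x + G.dpValue (j + 1) τ : ℝ) : EReal) := by
  rw [stageValue_eq G (weight_posSemidef hW hU hT hη j) hW hU hη, ← weight_succ]
  have hdev : ∀ z : (Vec nx × Vec nx) × Seeds, G.deviation (G.weight j)
      (G.stage (G.saddle (G.weight j) (G.dpValue j) τ).1 q
        (linearRule (stageGain G.A (G.weight j) G.B G.U G.η) x).toFun (x + z.1.1) x z.2) = 0 :=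
    fun z => G.deviation_eq_zero _ rfl
  simp only [hdev, ENNReal.ofReal_zero, lintegral_zero, EReal.coe_ennreal_zero, add_zero]
  have h := G.payoff_saddle_ge (G.weight j) (G.dpValue j) τ q
  refine EReal.coe_le_coe_iff.2 ?_
  simp only [dpValue]
  linarith

lemma minMax_eq (hW : G.W.PosSemidef) (hU : G.U.PosDef) (hT : G.T.PosSemidef)
    (hη : 0 ≤ G.η) (j : ℕ) :
    G.minMax j = fun x τ => ((quad (G.weight j) x + G.dpValue j τ : ℝ) : EReal) := by
  induction j with
  | zero => exact terminalValue_eq hT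
  | succ j ih =>
    funext x τ
    rw [minMax, ih]
    refine le_antisymm ?_ (le_iInf fun pκ => ?_)
    · exact iInf_le_of_le (_, _) (iSup_le fun q => stageValue_saddle_le hW hU hT hη j q x τ)
    · exact le_iSup_of_le _ (le_stageValue_saddle hW hU hT hη j pκ.1 pκ.2 x τ)

lemma maxMin_eq (hW : G.W.PosSemidef) (hU : G.U.PosDef) (hT : G.T.PosSemidef)
    (hη : 0 ≤ G.η) (j : ℕ) :
    G.maxMin j = fun x τ => ((quad (G.weight j) x + G.dpValue j τ : ℝ) : EReal) := by
  induction j with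
  | zero => exact terminalValue_eq hT
  | succ j ih =>
    funext x τ
    rw [maxMin, ih]
    refine le_antisymm (iSup_le fun q => ?_) ?_
    · exact iInf_le_of_le (_, _) (stageValue_saddle_le hW hU hT hη j q x τ)
    · exact le_iSup_of_le _ (le_iInf fun pκ => le_stageValue_saddle hW hU hT hη j pκ.1 pκ.2 x τ)

variable (G)

/-! ### The play as a random process -/

/-- The information of both players at the beginning of stage `k`: the prediction, the holding
time, and the records. -/
abbrev Hist (nx nu k : ℕ) := Vec nx × ℕ × (Fin k → CRec nx nu) × (Fin k → ARec)

/-- The information of both players in a snapshot. -/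
def Snapshot.hist {k : ℕ} (s : Snapshot nx nu k) : Hist nx nu k := (s.xbar, s.τ, s.crec, s.arec)

/-- The estimation gap `x̂ˢ - x̄` and the sensor error `x - x̂ˢ`, when the measurement noise
is `v`. -/
def errors {k : ℕ} (s : Snapshot nx nu k) (v : Vec ny) : Vec nx × Vec nx :=
  (G.sensorEstimate s.x s.pred v - s.xbar, s.x - G.sensorEstimate s.x s.pred v)

variable (π : Controller nx nu) (ρ : Attacker)

/-- The outcome of stage `k` as a function of the information `h`, the estimation gap `e` and the
seeds. -/
def histOutcome {k : ℕ} (h : Hist nx nu k) (e : Vec nx) (θ : Seeds) : Outcome nx nu :=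
  G.stage (π.sched k h.2.2.1 h.1 h.2.1) (ρ.prob k h.2.2.2 h.2.1) (π.ctrl k h.2.2.1 h.1 h.2.1)
    (h.1 + e) h.1 θ

/-- The acknowledgment of stage `k` as a function of the information and the seeds. -/
def histAck {k : ℕ} (h : Hist nx nu k) (θ : Seeds) : Bool :=
  G.ack (π.sched k h.2.2.1 h.1 h.2.1) (ρ.prob k h.2.2.2 h.2.1) θ

/-- The information at the beginning of the next stage. -/
def histStep {k : ℕ} (h : Hist nx nu k) (e : Vec nx) (θ : Seeds) : Hist nx nu (k + 1) :=
  let o := G.histOutcome π ρ h e θ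
  (G.nextPred o, nextHold h.2.1 o,
    Fin.snoc (α := fun _ => CRec nx nu) h.2.2.1 (h.1, h.2.1, o.ν, o.γ, o.recv, o.u),
    Fin.snoc (α := fun _ => ARec) h.2.2.2 (h.2.1, o.a, o.γ))

lemma snapOutcome_eq {k : ℕ} (s : Snapshot nx nu k) (n : Noise nx ny) :
    G.snapOutcome π ρ s n = G.histOutcome π ρ s.hist (G.errors s n.2.1).1 n.2.2 := by
  simp only [snapOutcome, histOutcome, Snapshot.hist, errors, add_sub_cancel]

lemma hist_play_succ (ω : Sample nx ny) (k : ℕ) :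
    (G.play π ρ ω (k + 1)).hist
      = G.histStep π ρ (G.play π ρ ω k).hist (G.errors (G.play π ρ ω k) (ω.2 k).2.1).1
          (ω.2 k).2.2 := by
  simp only [histStep, ← snapOutcome_eq]
  rfl

lemma errors_play_zero (ω : Sample nx ny) (v : Vec ny) :
    G.errors (G.play π ρ ω 0) v
      = (act G.kalmanGain (act G.C ω.1 + v), ω.1 - act G.kalmanGain (act G.C ω.1 + v)) := by
  simp [errors, play, sensorEstimate, act_zero]

/-- The errors evolve by the filtering step; a reception closes the estimation gap. -/
lemma errors_play_succ (ω : Sample nx ny) (k : ℕ) (v : Vec ny) :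
    G.errors (G.play π ρ ω (k + 1)) v
      = G.propagateCLM
        ((if G.histAck π ρ (G.play π ρ ω k).hist (ω.2 k).2.2 then 0
            else (G.errors (G.play π ρ ω k) (ω.2 k).2.1).1,
          (G.errors (G.play π ρ ω k) (ω.2 k).2.1).2), ((ω.2 k).1, v)) := by
  set s := G.play π ρ ω k with hs
  set n := ω.2 k with hn
  set xs := G.sensorEstimate s.x s.pred n.2.1 with hxs
  set o := G.snapOutcome π ρ s n with ho
  have hx : (G.play π ρ ω (k + 1)).x = act G.A s.x + act G.B o.u + n.1 := rfl
  have hpred : (G.play π ρ ω (k + 1)).pred = act G.A xs + act G.B o.u := rfl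
  have hxbar : (G.play π ρ ω (k + 1)).xbar = act G.A o.xhat + act G.B o.u := rfl
  have hgap : xs - o.xhat
      = if G.histAck π ρ s.hist n.2.2 then 0 else (G.errors s n.2.1).1 := by
    have : o.xhat = if G.histAck π ρ s.hist n.2.2 then xs else s.xbar := G.stage_xhat _ _ _ _ _ _
    rw [this]
    split_ifs
    · exact sub_self _
    · rfl
  have hd : (G.play π ρ ω (k + 1)).x - (G.play π ρ ω (k + 1)).pred
      = act G.A (s.x - xs) + n.1 := by
    rw [hx, hpred, act_sub]; abel
  have hinnov : (act G.C (G.play π ρ ω (k + 1)).x + v) - act G.C (G.play π ρ ω (k + 1)).pred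
      = act G.C (act G.A (s.x - xs) + n.1) + v := by
    rw [← hd, act_sub]; abel
  rw [propagateCLM_apply, ← hgap]
  refine Prod.ext ?_ ?_
  · change (G.play π ρ ω (k + 1)).pred + act G.kalmanGain
        ((act G.C (G.play π ρ ω (k + 1)).x + v) - act G.C (G.play π ρ ω (k + 1)).pred)
        - (G.play π ρ ω (k + 1)).xbar
      = act G.A (xs - o.xhat) + act G.kalmanGain (act G.C (act G.A (s.x - xs) + n.1) + v)
    rw [hinnov, hpred, hxbar, act_sub G.A xs]
    abel
  · change (G.play π ρ ω (k + 1)).x - ((G.play π ρ ω (k + 1)).pred + act G.kalmanGain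
        ((act G.C (G.play π ρ ω (k + 1)).x + v) - act G.C (G.play π ρ ω (k + 1)).pred))
      = act G.A (s.x - xs) + n.1 - act G.kalmanGain (act G.C (act G.A (s.x - xs) + n.1) + v)
    rw [hinnov, ← hd]
    abel

/-- If nothing is received, then the next information does not depend on the estimation gap. -/
lemma histStep_of_not_ack {k : ℕ} (h : Hist nx nu k) (e e' : Vec nx) (θ : Seeds)
    (hack : G.histAck π ρ h θ = false) : G.histStep π ρ h e θ = G.histStep π ρ h e' θ := by
  have h1 : ∀ e, G.histOutcome π ρ h e θ = G.histOutcome π ρ h 0 θ := fun e => by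
    have hγ : ∀ e, (G.histOutcome π ρ h e θ).recv = 0 := fun e => by
      simp only [histOutcome, stage_recv]
      rw [histAck] at hack
      simp [hack]
    have hx : ∀ e, (G.histOutcome π ρ h e θ).xhat = h.1 := fun e => by
      simp only [histOutcome, stage_xhat]
      rw [histAck] at hack
      simp [hack]
    have hu : ∀ e, (G.histOutcome π ρ h e θ).u
        = π.ctrl k h.2.2.1 h.1 h.2.1 (decide (θ.1 < π.sched k h.2.2.1 h.1 h.2.1)) false 0
            θ.2.2.2 := fun e => by
      simp only [histOutcome, stage_u]
      rw [histAck] at hack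
      simp [hack]
    have ext : ∀ o o' : Outcome nx nu, o.ν = o'.ν → o.a = o'.a → o.γ = o'.γ → o.recv = o'.recv →
        o.xhat = o'.xhat → o.u = o'.u → o = o' := by
      rintro ⟨⟩ ⟨⟩ rfl rfl rfl rfl rfl rfl
      rfl
    exact ext _ _ rfl rfl rfl (by rw [hγ, hγ]) (by rw [hx, hx]) (by rw [hu, hu])
  simp only [histStep, h1]

/-! ### Measurability of the play -/

lemma measurable_snoc {α β : Type*} [MeasurableSpace α] [MeasurableSpace β] {k : ℕ}
    {f : α → Fin k → β} {g : α → β} (hf : Measurable f) (hg : Measurable g) :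
    Measurable fun x => (Fin.snoc (α := fun _ => β) (f x) (g x) : Fin (k + 1) → β) := by
  refine measurable_pi_lambda _ fun i => ?_
  induction i using Fin.lastCases with
  | last => simpa using hg
  | cast i => simpa using measurable_pi_iff.1 hf i

section

variable {α : Type*} [MeasurableSpace α] {k : ℕ} {h : α → Hist nx nu k} {e : α → Vec nx}
  {θ : α → Seeds}

lemma measurable_sched (hh : Measurable h) :
    Measurable fun x => π.sched k (h x).2.2.1 (h x).1 (h x).2.1 :=
  (π.sched_meas k).comp ((hh.snd.snd.fst).prodMk (hh.fst.prodMk hh.snd.fst))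

lemma measurable_prob (hh : Measurable h) :
    Measurable fun x => ρ.prob k (h x).2.2.2 (h x).2.1 :=
  (measurable_of_countable fun z : (Fin k → ARec) × ℕ => ρ.prob k z.1 z.2).comp
    (hh.snd.snd.snd.prodMk hh.snd.fst)

lemma measurable_histAck (hh : Measurable h) (hθ : Measurable θ) :
    Measurable fun x => G.histAck π ρ (h x) (θ x) :=
  G.measurable_ack (measurable_sched π hh) (measurable_prob ρ hh) hθ

lemma measurable_histOutcome_xhat (hh : Measurable h) (he : Measurable e) (hθ : Measurable θ) :
    Measurable fun x => (G.histOutcome π ρ (h x) (e x) (θ x)).xhat :=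
  G.measurable_stage_xhat (measurable_sched π hh) (measurable_prob ρ hh) (hh.fst.add he) hh.fst hθ

lemma measurable_histOutcome_u (hh : Measurable h) (he : Measurable e) (hθ : Measurable θ) :
    Measurable fun x => (G.histOutcome π ρ (h x) (e x) (θ x)).u := by
  refine G.measurable_stage_u (measurable_sched π hh) (measurable_prob ρ hh) (hh.fst.add he) hθ ?_
  have hh' : Measurable fun z : α × Bool × Bool × Vec nx × I => h z.1 := hh.comp measurable_fst
  exact (π.ctrl_meas k).comp (hh'.snd.snd.fst.prodMk (hh'.fst.prodMk (hh'.snd.fst.prodMk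
    measurable_snd)))

lemma measurable_histStep (hh : Measurable h) (he : Measurable e) (hθ : Measurable θ) :
    Measurable fun x => G.histStep π ρ (h x) (e x) (θ x) := by
  have hγ := G.measurable_histAck π ρ hh hθ
  have hν : Measurable fun x => decide ((θ x).1 < π.sched k (h x).2.2.1 (h x).1 (h x).2.1) :=
    measurable_decide_lt hθ.fst (measurable_sched π hh)
  have ha : Measurable fun x => decide ((θ x).2.1 < ρ.prob k (h x).2.2.2 (h x).2.1) :=
    measurable_decide_lt hθ.snd.fst (measurable_prob ρ hh)
  have hrecv : Measurable fun x => (G.histOutcome π ρ (h x) (e x) (θ x)).recv :=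
    G.measurable_stage_recv (measurable_sched π hh) (measurable_prob ρ hh) (hh.fst.add he) hθ
  have hxhat := G.measurable_histOutcome_xhat π ρ hh he hθ
  have hu := G.measurable_histOutcome_u π ρ hh he hθ
  have hpred : Measurable fun x => G.nextPred (G.histOutcome π ρ (h x) (e x) (θ x)) := by
    unfold nextPred
    fun_prop
  have hhold : Measurable fun x => nextHold (h x).2.1 (G.histOutcome π ρ (h x) (e x) (θ x)) :=
    measurable_ite_bool hγ measurable_const
      ((measurable_of_countable fun t : ℕ => t + 1).comp hh.snd.fst)
  exact hpred.prodMk (hhold.prodMk ((measurable_snoc hh.snd.snd.fst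
    (hh.fst.prodMk (hh.snd.fst.prodMk (hν.prodMk (hγ.prodMk (hrecv.prodMk hu)))))).prodMk
    (measurable_snoc hh.snd.snd.snd (hh.snd.fst.prodMk (ha.prodMk hγ)))))

end

lemma measurable_play (k : ℕ) :
    Measurable (fun ω : Sample nx ny => (G.play π ρ ω k).x) ∧
    Measurable (fun ω : Sample nx ny => (G.play π ρ ω k).pred) ∧
    Measurable (fun ω : Sample nx ny => (G.play π ρ ω k).hist) := by
  induction k with
  | zero =>
    refine ⟨measurable_fst, measurable_const, ?_⟩
    change Measurable fun _ => ((0, 0, Fin.elim0, Fin.elim0) : Hist nx nu 0)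
    exact measurable_const
  | succ k ih =>
    obtain ⟨hx, hpred, hh⟩ := ih
    have hn : Measurable fun ω : Sample nx ny => ω.2 k := (measurable_pi_apply k).comp measurable_snd
    have hxs : Measurable fun ω : Sample nx ny =>
        G.sensorEstimate (G.play π ρ ω k).x (G.play π ρ ω k).pred (ω.2 k).2.1 := by
      unfold sensorEstimate
      fun_prop
    have he : Measurable fun ω : Sample nx ny =>
        (G.errors (G.play π ρ ω k) (ω.2 k).2.1).1 := hxs.sub hh.fst
    have hu : Measurable fun ω : Sample nx ny =>
        (G.snapOutcome π ρ (G.play π ρ ω k) (ω.2 k)).u := by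
      simp only [snapOutcome_eq]
      exact G.measurable_histOutcome_u π ρ hh he hn.snd.snd
    refine ⟨?_, ?_, ?_⟩
    · change Measurable fun ω : Sample nx ny => act G.A (G.play π ρ ω k).x
        + act G.B (G.snapOutcome π ρ (G.play π ρ ω k) (ω.2 k)).u + (ω.2 k).1
      fun_prop
    · change Measurable fun ω : Sample nx ny =>
        act G.A (G.sensorEstimate (G.play π ρ ω k).x (G.play π ρ ω k).pred (ω.2 k).2.1)
        + act G.B (G.snapOutcome π ρ (G.play π ρ ω k) (ω.2 k)).u
      fun_prop
    · simp only [hist_play_succ]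
      exact G.measurable_histStep π ρ hh he hn.snd.snd

lemma measurable_hist (k : ℕ) : Measurable fun ω : Sample nx ny => (G.play π ρ ω k).hist :=
  (G.measurable_play π ρ k).2.2

lemma measurable_noise (k : ℕ) : Measurable fun ω : Sample nx ny => ω.2 k :=
  (measurable_pi_apply k).comp measurable_snd

lemma measurable_errors {α : Type*} [MeasurableSpace α] (k : ℕ) {ω : α → Sample nx ny}
    {v : α → Vec ny} (hω : Measurable ω) (hv : Measurable v) :
    Measurable fun x => G.errors (G.play π ρ (ω x) k) (v x) := by
  have hx := (G.measurable_play π ρ k).1.comp hω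
  have hpred := (G.measurable_play π ρ k).2.1.comp hω
  have hxbar := (G.measurable_hist π ρ k).fst.comp hω
  simp only [Function.comp_def, Snapshot.hist] at hx hpred hxbar
  unfold errors sensorEstimate
  fun_prop

end Model

/-! ### Independence of the noise from the past -/

/-- Replacing one coordinate of an i.i.d. sequence by a fresh copy preserves the law. -/
lemma measurePreserving_update_infinitePi {E : Type*} [MeasurableSpace E] (ν : Measure E)
    [IsProbabilityMeasure ν] (k : ℕ) :
    MeasurePreserving (fun z : (ℕ → E) × E => Function.update z.1 k z.2)
      ((Measure.infinitePi fun _ : ℕ => ν).prod ν) (Measure.infinitePi fun _ : ℕ => ν) := by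
  have hm : Measurable fun z : (ℕ → E) × E => Function.update z.1 k z.2 := by
    refine measurable_pi_lambda _ fun i => ?_
    by_cases hi : i = k
    · subst hi
      simpa using measurable_snd
    · simpa [hi] using measurable_pi_iff.1 measurable_fst i
  refine ⟨hm, Measure.eq_infinitePi _ fun s t ht => ?_⟩
  rw [Measure.map_apply hm (MeasurableSet.pi s.countable_toSet fun i _ => ht i)]
  have hpre : (fun z : (ℕ → E) × E => Function.update z.1 k z.2) ⁻¹' Set.pi s t
      = (Set.pi (s.erase k : Finset ℕ) t) ×ˢ (if k ∈ s then t k else Set.univ) := by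
    ext z
    simp only [Set.mem_preimage, Set.mem_pi, Finset.mem_coe, Set.mem_prod, Finset.mem_erase]
    constructor
    · refine fun h => ⟨fun i hi => by simpa [hi.1] using h i hi.2, ?_⟩
      split_ifs with hk
      · simpa using h k hk
      · trivial
    · rintro ⟨h1, h2⟩ i hi
      by_cases hik : i = k
      · subst hik
        simpa [hi] using h2
      · simpa [hik] using h1 i ⟨hik, hi⟩
  rw [hpre, Measure.prod_prod, Measure.infinitePi_pi _ fun i _ => ht i]
  split_ifs with hk
  · exact Finset.prod_erase_mul s (fun i => ν (t i)) hk
  · rw [measure_univ, mul_one, Finset.erase_eq_of_notMem hk]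

namespace Model

variable {nx nu ny : ℕ} (G : Model nx nu ny) (π : Controller nx nu) (ρ : Attacker)

instance : IsProbabilityMeasure G.noiseLaw := by unfold noiseLaw; infer_instance

instance : IsProbabilityMeasure G.law := by unfold law; infer_instance

/-- Replace the noise of stage `k` by another value. -/
def resample (k : ℕ) (z : Sample nx ny × Noise nx ny) : Sample nx ny :=
  (z.1.1, Function.update z.1.2 k z.2)

lemma measurePreserving_resample (k : ℕ) :
    MeasurePreserving (resample k) (G.law.prod G.noiseLaw) G.law := by
  have h1 := measurePreserving_prodAssoc (multivariateGaussian (0 : Vec nx) (G.f G.P))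
    (Measure.infinitePi fun _ : ℕ => G.noiseLaw) G.noiseLaw
  have h2 := (MeasurePreserving.id (multivariateGaussian (0 : Vec nx) (G.f G.P))).prod
    (measurePreserving_update_infinitePi G.noiseLaw k)
  exact h2.comp h1

/-- The play up to the beginning of stage `k` is determined by the noise of the stages `< k`. -/
lemma play_congr {ω ω' : Sample nx ny} {k : ℕ} (h0 : ω.1 = ω'.1) (h : ∀ i < k, ω.2 i = ω'.2 i) :
    G.play π ρ ω k = G.play π ρ ω' k := by
  induction k with
  | zero => simp only [play, h0]
  | succ k ih =>
    have h1 := ih fun i hi => h i (hi.trans k.lt_succ_self)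
    have h2 := h k k.lt_succ_self
    simp only [play, h1, h2]

lemma play_resample (k : ℕ) (z : Sample nx ny × Noise nx ny) :
    G.play π ρ (resample k z) k = G.play π ρ z.1 k :=
  G.play_congr π ρ rfl fun i hi => by simp [resample, hi.ne]

lemma noise_resample (k : ℕ) (z : Sample nx ny × Noise nx ny) : (resample k z).2 k = z.2 := by
  simp [resample]

/-- The noise of stage `k` is independent of the play up to that stage. -/
lemma lintegral_fresh_noise (k : ℕ) {Φ : Sample nx ny → ℝ≥0∞} (hΦ : Measurable Φ) :
    ∫⁻ ω, Φ ω ∂G.law = ∫⁻ ω, ∫⁻ n, Φ (resample k (ω, n)) ∂G.noiseLaw ∂G.law := by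
  have h := G.measurePreserving_resample k
  rw [← h.lintegral_comp hΦ, lintegral_prod]
  exact (hΦ.comp h.measurable).aemeasurable

lemma integral_fresh_noise (k : ℕ) {Φ : Sample nx ny → ℝ} (hΦ : Integrable Φ G.law) :
    ∫ ω, Φ ω ∂G.law = ∫ ω, ∫ n, Φ (resample k (ω, n)) ∂G.noiseLaw ∂G.law := by
  have h := G.measurePreserving_resample k
  have hi : Integrable (fun z => Φ (resample k z)) (G.law.prod G.noiseLaw) :=
    h.integrable_comp_of_integrable hΦ
  rw [← integral_prod _ hi, ← integral_map h.measurable.aemeasurable, h.map_eq]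
  rw [h.map_eq]
  exact hΦ.aestronglyMeasurable

lemma lintegral_noiseLaw {Φ : Noise nx ny → ℝ≥0∞} (hΦ : Measurable Φ) :
    ∫⁻ n, Φ n ∂G.noiseLaw
      = ∫⁻ v, ∫⁻ θ, ∫⁻ w, Φ (w, v, θ) ∂multivariateGaussian 0 G.Q ∂volume
          ∂multivariateGaussian 0 G.R := by
  rw [noiseLaw, lintegral_prod_symm _ hΦ.aemeasurable, lintegral_prod]
  exact Measurable.aemeasurable (by fun_prop)

/-! ### The conditional law of the errors -/

/-- The beliefs as a kernel. -/
def beliefKernel : Kernel ℕ (Vec nx × Vec nx) := Kernel.ofFunOfCountable G.belief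

instance : IsMarkovKernel G.beliefKernel := ⟨fun τ => (G.isGaussian_belief τ).toIsProbabilityMeasure⟩

lemma measurable_lintegral_belief {α : Type*} [MeasurableSpace α] {t : α → ℕ} (ht : Measurable t)
    {Φ : α × (Vec nx × Vec nx) → ℝ≥0∞} (hΦ : Measurable Φ) :
    Measurable fun x => ∫⁻ z, Φ (x, z) ∂G.belief (t x) :=
  hΦ.lintegral_kernel_prod_right' (κ := G.beliefKernel.comap t ht)

/-- The Bayesian update: after an unsuccessful stage the belief is propagated; after a reception
the sensor error is `N(0, P)` whatever the received value is. -/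
lemma lintegral_belief_update (hQ : G.Q.PosDef) (hR : G.R.PosDef) (hP : G.IsSteadyState) (τ : ℕ)
    (γ : Bool) {Ψ : Vec nx × (Vec nx × Vec nx) → ℝ≥0∞} (hΨ : Measurable Ψ)
    (hγ : γ = false → ∀ e e' z, Ψ (e, z) = Ψ (e', z)) :
    ∫⁻ z, ∫⁻ w, ∫⁻ v, Ψ (z.1, G.propagateCLM ((if γ then 0 else z.1, z.2), (w, v)))
        ∂multivariateGaussian 0 G.R ∂multivariateGaussian 0 G.Q ∂G.belief τ
      = ∫⁻ z, ∫⁻ z', Ψ (z.1, z') ∂G.belief (if γ then 0 else τ + 1) ∂G.belief τ := by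
  cases γ with
  | false =>
    have h0 : ∀ e z, Ψ (e, z) = Ψ (0, z) := fun e z => hγ rfl e 0 z
    simp only [Bool.false_eq_true, if_false, h0, lintegral_const, measure_univ, mul_one]
    rw [belief_succ, G.lintegral_propagate _ (by fun_prop)]
  | true =>
    obtain ⟨μ, hμ, h⟩ := G.exists_belief_eq_prod hQ hR hP τ
    have hT : Measurable G.propagateCLM := G.propagateCLM.continuous.measurable
    simp only [if_true]
    rw [h, lintegral_prod, lintegral_prod]
    · refine lintegral_congr fun e => ?_
      simp only [lintegral_const, measure_univ, mul_one]
      rw [belief_zero, G.lintegral_propagate _ (by fun_prop), lintegral_prod, lintegral_dirac]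
      exact Measurable.aemeasurable (by fun_prop)
    · exact Measurable.aemeasurable (by fun_prop)
    · exact Measurable.aemeasurable (by fun_prop)

/-- The seeds and the state noise of stage `k` are independent of the information and of the
errors of that stage. -/
lemma lintegral_fresh_seeds (k : ℕ)
    {F : Hist nx nu k × (Vec nx × Vec nx) × Seeds × Vec nx → ℝ≥0∞} (hF : Measurable F) :
    ∫⁻ ω, F ((G.play π ρ ω k).hist, G.errors (G.play π ρ ω k) (ω.2 k).2.1, (ω.2 k).2.2, (ω.2 k).1)
        ∂G.law
      = ∫⁻ ω, ∫⁻ θ, ∫⁻ w, F ((G.play π ρ ω k).hist, G.errors (G.play π ρ ω k) (ω.2 k).2.1, θ, w)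
          ∂multivariateGaussian 0 G.Q ∂volume ∂G.law := by
  have hh := G.measurable_hist π ρ k
  have hn := measurable_noise (nx := nx) (ny := ny) k
  have he : Measurable fun ω : Sample nx ny => G.errors (G.play π ρ ω k) (ω.2 k).2.1 :=
    G.measurable_errors π ρ k measurable_id hn.snd.fst
  have he' : ∀ ω : Sample nx ny, Measurable fun v => G.errors (G.play π ρ ω k) v := fun ω =>
    G.measurable_errors π ρ k measurable_const measurable_id
  have hm : Measurable fun y : Hist nx nu k × (Vec nx × Vec nx) =>
      ∫⁻ θ, ∫⁻ w, F (y.1, y.2, θ, w) ∂multivariateGaussian 0 G.Q := by fun_prop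
  rw [G.lintegral_fresh_noise k (by fun_prop), G.lintegral_fresh_noise k
    (Φ := fun ω => ∫⁻ θ, ∫⁻ w, F ((G.play π ρ ω k).hist, G.errors (G.play π ρ ω k) (ω.2 k).2.1,
      θ, w) ∂multivariateGaussian 0 G.Q) (hm.comp (hh.prodMk he))]
  refine lintegral_congr fun ω => ?_
  simp only [play_resample, noise_resample]
  have he'' := he' ω
  rw [G.lintegral_noiseLaw (by fun_prop), G.lintegral_noiseLaw (by fun_prop)]
  simp

/-- Given the information of both players, the pair (estimation gap, sensor error) has the law
`belief τ`, whatever the strategies are. -/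
theorem lintegral_hist_errors (hQ : G.Q.PosDef) (hR : G.R.PosDef) (hP : G.IsSteadyState) (k : ℕ)
    {Φ : Hist nx nu k × (Vec nx × Vec nx) → ℝ≥0∞} (hΦ : Measurable Φ) :
    ∫⁻ ω, Φ ((G.play π ρ ω k).hist, G.errors (G.play π ρ ω k) (ω.2 k).2.1) ∂G.law
      = ∫⁻ ω, ∫⁻ z, Φ ((G.play π ρ ω k).hist, z) ∂G.belief (G.play π ρ ω k).τ ∂G.law := by
  induction k with
  | zero =>
    have hn := measurable_noise (nx := nx) (ny := ny) 0
    have hh0 : ∀ ω : Sample nx ny, (G.play π ρ ω 0).hist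
        = ((0, 0, Fin.elim0, Fin.elim0) : Hist nx nu 0) := fun ω => rfl
    have hτ0 : ∀ ω : Sample nx ny, (G.play π ρ ω 0).τ = 0 := fun ω => rfl
    simp only [hh0, hτ0, errors_play_zero, lintegral_const, measure_univ, mul_one]
    rw [G.lintegral_fresh_noise 0 (by fun_prop), G.lintegral_belief_zero hQ hP (by fun_prop)]
    simp only [resample, Function.update_self]
    rw [law, lintegral_prod]
    · refine lintegral_congr fun x => ?_
      simp only [lintegral_const, measure_univ, mul_one]
      rw [G.lintegral_noiseLaw (by fun_prop)]
      simp
    · exact Measurable.aemeasurable (by fun_prop)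
  | succ k ih =>
    have hh := G.measurable_hist π ρ k
    have hh' := G.measurable_hist π ρ (k + 1)
    have hn := measurable_noise (nx := nx) (ny := ny) (k + 1)
    have hT : Measurable G.propagateCLM := G.propagateCLM.continuous.measurable
    have he : Measurable fun ω : Sample nx ny =>
        G.errors (G.play π ρ ω (k + 1)) (ω.2 (k + 1)).2.1 :=
      G.measurable_errors π ρ (k + 1) measurable_id hn.snd.fst
    have he' : ∀ ω : Sample nx ny, Measurable fun v => G.errors (G.play π ρ ω (k + 1)) v :=
      fun ω => G.measurable_errors π ρ (k + 1) measurable_const measurable_id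
    have hstep : Measurable fun y : Hist nx nu k × (Vec nx × Vec nx) × Seeds × Vec nx =>
        G.histStep π ρ y.1 y.2.1.1 y.2.2.1 :=
      G.measurable_histStep π ρ (by fun_prop) (by fun_prop) (by fun_prop)
    have hack : Measurable fun y : Hist nx nu k × (Vec nx × Vec nx) × Seeds × Vec nx =>
        G.histAck π ρ y.1 y.2.2.1 :=
      G.measurable_histAck π ρ (by fun_prop) (by fun_prop)
    have hgap : Measurable fun y : Hist nx nu k × (Vec nx × Vec nx) × Seeds × Vec nx =>
        if G.histAck π ρ y.1 y.2.2.1 then (0 : Vec nx) else y.2.1.1 :=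
      measurable_ite_bool hack measurable_const (by fun_prop)
    have hhold : Measurable fun y : Hist nx nu k × (Vec nx × Vec nx) × Seeds × Vec nx =>
        if G.histAck π ρ y.1 y.2.2.1 then 0 else y.1.2.1 + 1 :=
      measurable_ite_bool hack measurable_const (by fun_prop)
    -- the mean of `Φ` at stage `k + 1`, from the errors and the noise of stage `k`
    let F₁ : Hist nx nu k × (Vec nx × Vec nx) × Seeds × Vec nx → ℝ≥0∞ := fun y =>
      ∫⁻ v, Φ (G.histStep π ρ y.1 y.2.1.1 y.2.2.1, G.propagateCLM
        ((if G.histAck π ρ y.1 y.2.2.1 then 0 else y.2.1.1, y.2.1.2), (y.2.2.2, v)))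
        ∂multivariateGaussian 0 G.R
    let F₂ : Hist nx nu k × (Vec nx × Vec nx) × Seeds × Vec nx → ℝ≥0∞ := fun y =>
      ∫⁻ z', Φ (G.histStep π ρ y.1 y.2.1.1 y.2.2.1, z')
        ∂G.belief (if G.histAck π ρ y.1 y.2.2.1 then 0 else y.1.2.1 + 1)
    have hF₁ : Measurable F₁ := by
      refine Measurable.lintegral_prod_right' (f := fun p :
        (Hist nx nu k × (Vec nx × Vec nx) × Seeds × Vec nx) × Vec ny =>
        Φ (G.histStep π ρ p.1.1 p.1.2.1.1 p.1.2.2.1, G.propagateCLM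
        ((if G.histAck π ρ p.1.1 p.1.2.2.1 then 0 else p.1.2.1.1, p.1.2.1.2),
          (p.1.2.2.2, p.2)))) ?_
      have hfst : Measurable fun p :
          (Hist nx nu k × (Vec nx × Vec nx) × Seeds × Vec nx) × Vec ny => p.1 := measurable_fst
      have h1 := hstep.comp hfst
      have h2 := hgap.comp hfst
      simp only [Function.comp_def] at h1 h2
      fun_prop
    have hF₂ : Measurable F₂ :=
      G.measurable_lintegral_belief hhold (Φ := fun p :
        (Hist nx nu k × (Vec nx × Vec nx) × Seeds × Vec nx) × (Vec nx × Vec nx) =>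
        Φ (G.histStep π ρ p.1.1 p.1.2.1.1 p.1.2.2.1, p.2))
        (hΦ.comp ((hstep.comp measurable_fst).prodMk measurable_snd))
    have hL : ∫⁻ ω, Φ ((G.play π ρ ω (k + 1)).hist,
          G.errors (G.play π ρ ω (k + 1)) (ω.2 (k + 1)).2.1) ∂G.law
        = ∫⁻ ω, F₁ ((G.play π ρ ω k).hist, G.errors (G.play π ρ ω k) (ω.2 k).2.1,
            (ω.2 k).2.2, (ω.2 k).1) ∂G.law := by
      rw [G.lintegral_fresh_noise (k + 1) (by fun_prop)]
      refine lintegral_congr fun ω => ?_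
      simp only [play_resample, noise_resample]
      have he'' := he' ω
      rw [G.lintegral_noiseLaw (by fun_prop)]
      simp only [lintegral_const, measure_univ, mul_one, F₁, hist_play_succ, errors_play_succ]
    have hR' : ∫⁻ ω, ∫⁻ z, Φ ((G.play π ρ ω (k + 1)).hist, z)
          ∂G.belief (G.play π ρ ω (k + 1)).τ ∂G.law
        = ∫⁻ ω, F₂ ((G.play π ρ ω k).hist, G.errors (G.play π ρ ω k) (ω.2 k).2.1,
            (ω.2 k).2.2, (ω.2 k).1) ∂G.law := by
      refine lintegral_congr fun ω => ?_
      simp only [F₂, ← hist_play_succ]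
      rfl
    have hm : ∀ F : Hist nx nu k × (Vec nx × Vec nx) × Seeds × Vec nx → ℝ≥0∞, Measurable F →
        Measurable fun y : Hist nx nu k × (Vec nx × Vec nx) =>
          ∫⁻ θ, ∫⁻ w, F (y.1, y.2, θ, w) ∂multivariateGaussian 0 G.Q := fun F hF => by fun_prop
    rw [hL, hR', G.lintegral_fresh_seeds π ρ k hF₁, G.lintegral_fresh_seeds π ρ k hF₂,
      ih (hm F₁ hF₁), ih (hm F₂ hF₂)]
    refine lintegral_congr fun ω => ?_
    have hswap : ∀ F : Hist nx nu k × (Vec nx × Vec nx) × Seeds × Vec nx → ℝ≥0∞, Measurable F →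
        ∫⁻ z, ∫⁻ θ, ∫⁻ w, F ((G.play π ρ ω k).hist, z, θ, w) ∂multivariateGaussian 0 G.Q ∂volume
            ∂G.belief (G.play π ρ ω k).τ
          = ∫⁻ θ, ∫⁻ z, ∫⁻ w, F ((G.play π ρ ω k).hist, z, θ, w) ∂multivariateGaussian 0 G.Q
            ∂G.belief (G.play π ρ ω k).τ ∂volume := fun F hF =>
      lintegral_lintegral_swap (Measurable.aemeasurable (by fun_prop))
    rw [hswap F₁ hF₁, hswap F₂ hF₂]
    refine lintegral_congr fun θ => ?_
    have h1 : Measurable fun p : Vec nx × (Vec nx × Vec nx) =>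
        G.histStep π ρ (G.play π ρ ω k).hist p.1 θ :=
      G.measurable_histStep π ρ measurable_const measurable_fst measurable_const
    have h2 := G.lintegral_belief_update hQ hR hP (G.play π ρ ω k).τ
      (G.histAck π ρ (G.play π ρ ω k).hist θ)
      (Ψ := fun p => Φ (G.histStep π ρ (G.play π ρ ω k).hist p.1 θ, p.2)) (by fun_prop)
      fun hγ e e' z => by simp only [G.histStep_of_not_ack π ρ _ e e' θ hγ]
    simp only [F₁, F₂, lintegral_const, measure_univ, mul_one]
    exact h2

/-- The joint law of information, errors and seeds at stage `k`. -/
lemma lintegral_hist_errors_seeds (hQ : G.Q.PosDef) (hR : G.R.PosDef) (hP : G.IsSteadyState)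
    (k : ℕ) {F : Hist nx nu k × (Vec nx × Vec nx) × Seeds → ℝ≥0∞} (hF : Measurable F) :
    ∫⁻ ω, F ((G.play π ρ ω k).hist, G.errors (G.play π ρ ω k) (ω.2 k).2.1, (ω.2 k).2.2) ∂G.law
      = ∫⁻ ω, ∫⁻ z, ∫⁻ θ, F ((G.play π ρ ω k).hist, z, θ) ∂volume
          ∂G.belief (G.play π ρ ω k).τ ∂G.law := by
  rw [G.lintegral_fresh_seeds π ρ k (F := fun y => F (y.1, y.2.1, y.2.2.1)) (by fun_prop)]
  simp only [lintegral_const, measure_univ, mul_one]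
  exact G.lintegral_hist_errors π ρ hQ hR hP k (Φ := fun y => ∫⁻ θ, F (y.1, y.2, θ))
    (by fun_prop)

end Model

namespace Model

variable {nx nu ny : ℕ} (G : Model nx nu ny) (π : Controller nx nu) (ρ : Attacker)

/-! ### Decomposition of the cost -/

/-- The outcome of stage `k` of the play. -/
def outcome (ω : Sample nx ny) (k : ℕ) : Outcome nx nu :=
  G.snapOutcome π ρ (G.play π ρ ω k) (ω.2 k)

/-- The weight of the estimate at stage `k`, where the cost-to-go has the weight `S_{k+1}`. -/
def estWeight (k : ℕ) : Matrix (Fin nx) (Fin nx) ℝ :=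
  estimateWeight G.A (G.weight (G.K - k)) G.B G.U G.η

/-- The part of the quadratic cost that stage `k` adds because of the estimation errors. -/
def estLoss (ω : Sample nx ny) (k : ℕ) : ℝ :=
  G.spread G.W (G.play π ρ ω k).τ
    + ind (G.outcome π ρ ω k).γ * G.gapSpread (G.estWeight k) (G.play π ρ ω k).τ

/-- The part of the cost of stage `k` that is governed by the two scheduling strategies. -/
def holdLoss (ω : Sample nx ny) (k : ℕ) : ℝ :=
  G.estLoss π ρ ω k + (G.cs * ind (G.outcome π ρ ω k).ν - G.ca * ind (G.outcome π ρ ω k).a)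

/-- The part of the realized cost that is governed by the two scheduling strategies. -/
def holdCost (ω : Sample nx ny) : ℝ :=
  (G.K : ℝ)⁻¹ * (∑ k ∈ Finset.range (G.K + 1), G.η ^ k * G.holdLoss π ρ ω k
    + G.η ^ (G.K + 1) * G.spread G.T (G.play π ρ ω (G.K + 1)).τ)

/-- The deviation cost of the input of stage `k` from the linear law `L_k x̂_k`. -/
def devLoss (ω : Sample nx ny) (k : ℕ) : ℝ := G.deviation (G.weight (G.K - k)) (G.outcome π ρ ω k)

/-- The total expected cost of the deviations of the input from the linear law. -/
def excess : ℝ≥0∞ :=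
  ∫⁻ ω, ENNReal.ofReal ((G.K : ℝ)⁻¹ * (∑ k ∈ Finset.range (G.K + 1),
    G.η ^ k * G.devLoss π ρ ω k)) ∂G.law

section Measurability

lemma measurable_hold (k : ℕ) : Measurable fun ω : Sample nx ny => (G.play π ρ ω k).τ :=
  (G.measurable_hist π ρ k).snd.fst

lemma measurable_xbar (k : ℕ) : Measurable fun ω : Sample nx ny => (G.play π ρ ω k).xbar :=
  (G.measurable_hist π ρ k).fst

lemma measurable_outcome_errors (k : ℕ) :
    Measurable fun ω : Sample nx ny => G.errors (G.play π ρ ω k) (ω.2 k).2.1 :=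
  G.measurable_errors π ρ k measurable_id (measurable_noise k).snd.fst

lemma outcome_eq (ω : Sample nx ny) (k : ℕ) : G.outcome π ρ ω k
    = G.histOutcome π ρ (G.play π ρ ω k).hist (G.errors (G.play π ρ ω k) (ω.2 k).2.1).1
      (ω.2 k).2.2 := G.snapOutcome_eq π ρ _ _

lemma measurable_outcome_xhat (k : ℕ) :
    Measurable fun ω : Sample nx ny => (G.outcome π ρ ω k).xhat := by
  simp only [outcome_eq]
  exact G.measurable_histOutcome_xhat π ρ (G.measurable_hist π ρ k)
    (G.measurable_outcome_errors π ρ k).fst (measurable_noise k).snd.snd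

lemma measurable_outcome_u (k : ℕ) :
    Measurable fun ω : Sample nx ny => (G.outcome π ρ ω k).u := by
  simp only [outcome_eq]
  exact G.measurable_histOutcome_u π ρ (G.measurable_hist π ρ k)
    (G.measurable_outcome_errors π ρ k).fst (measurable_noise k).snd.snd

lemma measurable_outcome_ν (k : ℕ) :
    Measurable fun ω : Sample nx ny => (G.outcome π ρ ω k).ν :=
  measurable_decide_lt (measurable_noise k).snd.snd.fst
    (measurable_sched π (G.measurable_hist π ρ k))

lemma measurable_outcome_a (k : ℕ) :
    Measurable fun ω : Sample nx ny => (G.outcome π ρ ω k).a :=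
  measurable_decide_lt (measurable_noise k).snd.snd.snd.fst
    (measurable_prob ρ (G.measurable_hist π ρ k))

lemma measurable_outcome_γ (k : ℕ) :
    Measurable fun ω : Sample nx ny => (G.outcome π ρ ω k).γ :=
  G.measurable_histAck π ρ (G.measurable_hist π ρ k) (measurable_noise k).snd.snd

lemma measurable_devLoss (k : ℕ) : Measurable fun ω : Sample nx ny => G.devLoss π ρ ω k := by
  have h1 := G.measurable_outcome_xhat π ρ k
  have h2 := G.measurable_outcome_u π ρ k
  unfold devLoss deviation
  fun_prop

lemma measurable_estLoss (k : ℕ) : Measurable fun ω : Sample nx ny => G.estLoss π ρ ω k := by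
  have h1 := G.measurable_hold π ρ k
  have h2 := G.measurable_outcome_γ π ρ k
  have h3 : ∀ g : ℕ → ℝ, Measurable fun ω : Sample nx ny => g (G.play π ρ ω k).τ := fun g =>
    (measurable_of_countable g).comp h1
  have h4 := h3 (G.spread G.W)
  have h5 := h3 (G.gapSpread (G.estWeight k))
  unfold estLoss
  fun_prop

end Measurability

section Integrability

lemma hold_le (ω : Sample nx ny) (k : ℕ) : (G.play π ρ ω k).τ ≤ k := by
  induction k with
  | zero => exact le_rfl
  | succ k ih =>
    change nextHold (G.play π ρ ω k).τ (G.outcome π ρ ω k) ≤ k + 1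
    unfold nextHold
    split_ifs <;> omega

/-- The holding time takes finitely many values, so that every function of it is integrable. -/
lemma integrable_hold (g : ℕ → ℝ) (k : ℕ) :
    Integrable (fun ω : Sample nx ny => g (G.play π ρ ω k).τ) G.law := by
  refine Integrable.of_bound ((measurable_of_countable g).comp
    (G.measurable_hold π ρ k)).aestronglyMeasurable (∑ t ∈ Finset.range (k + 1), |g t|)
    (ae_of_all _ fun ω => ?_)
  exact Finset.single_le_sum (f := fun t => |g t|) (fun t _ => abs_nonneg _)
    (Finset.mem_range.2 (Nat.lt_succ_of_le (G.hold_le π ρ ω k)))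

lemma integrable_estLoss (k : ℕ) : Integrable (fun ω => G.estLoss π ρ ω k) G.law := by
  refine (G.integrable_hold π ρ _ k).add ?_
  refine (G.integrable_hold π ρ (G.gapSpread (G.estWeight k)) k).bdd_mul (c := 1)
    (measurable_ind.comp (G.measurable_outcome_γ π ρ k)).aestronglyMeasurable
    (ae_of_all _ fun ω => ?_)
  rw [Real.norm_of_nonneg (ind_nonneg _)]
  exact ind_le_one _

lemma integrable_prices (k : ℕ) : Integrable (fun ω => G.cs * ind (G.outcome π ρ ω k).ν
    - G.ca * ind (G.outcome π ρ ω k).a) G.law :=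
  ((integrable_ind (G.measurable_outcome_ν π ρ k)).const_mul _).sub
    ((integrable_ind (G.measurable_outcome_a π ρ k)).const_mul _)

lemma integrable_holdLoss (k : ℕ) : Integrable (fun ω => G.holdLoss π ρ ω k) G.law :=
  (G.integrable_estLoss π ρ k).add (G.integrable_prices π ρ k)

end Integrability

/-- The mean of a discounted sum of nonnegative functions. -/
lemma lintegral_discounted {Ω : Type*} [MeasurableSpace Ω] (μ : Measure Ω) {c η : ℝ} (hc : 0 ≤ c)
    (hη : 0 ≤ η) (n : ℕ) {f : Ω → ℕ → ℝ} {t : Ω → ℝ} (hf : ∀ k, Measurable fun ω => f ω k)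
    (hf0 : ∀ ω, ∀ k < n, 0 ≤ f ω k) (ht0 : ∀ ω, 0 ≤ t ω) (ht : Measurable t) :
    ∫⁻ ω, ENNReal.ofReal (c * (∑ k ∈ Finset.range n, η ^ k * f ω k + η ^ n * t ω)) ∂μ
      = ENNReal.ofReal c * (∑ k ∈ Finset.range n,
          ENNReal.ofReal η ^ k * ∫⁻ ω, ENNReal.ofReal (f ω k) ∂μ
        + ENNReal.ofReal η ^ n * ∫⁻ ω, ENNReal.ofReal (t ω) ∂μ) := by
  have hpt : ∀ ω, ENNReal.ofReal (c * (∑ k ∈ Finset.range n, η ^ k * f ω k + η ^ n * t ω))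
      = ENNReal.ofReal c * (∑ k ∈ Finset.range n,
          ENNReal.ofReal η ^ k * ENNReal.ofReal (f ω k)
        + ENNReal.ofReal η ^ n * ENNReal.ofReal (t ω)) := fun ω => by
    have h : ∀ k ∈ Finset.range n, 0 ≤ η ^ k * f ω k := fun k hk =>
      mul_nonneg (pow_nonneg hη k) (hf0 ω k (Finset.mem_range.1 hk))
    rw [ENNReal.ofReal_mul hc, ENNReal.ofReal_add (Finset.sum_nonneg h)
      (mul_nonneg (pow_nonneg hη n) (ht0 ω)), ENNReal.ofReal_sum_of_nonneg h,
      ENNReal.ofReal_mul (pow_nonneg hη n), ENNReal.ofReal_pow hη]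
    congr 2
    exact Finset.sum_congr rfl fun k _ => by
      rw [ENNReal.ofReal_mul (pow_nonneg hη k), ENNReal.ofReal_pow hη]
  simp_rw [hpt]
  rw [lintegral_const_mul _ (by fun_prop), lintegral_add_right _ (by fun_prop),
    lintegral_finsetSum _ (by fun_prop), lintegral_const_mul _ (by fun_prop)]
  congr 2
  exact Finset.sum_congr rfl fun k _ => lintegral_const_mul _ (by fun_prop)

variable {G}

lemma estWeight_posSemidef (hW : G.W.PosSemidef) (hU : G.U.PosDef) (hT : G.T.PosSemidef)
    (hη : 0 ≤ G.η) (k : ℕ) : (G.estWeight k).PosSemidef :=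
  estimateWeight_posSemidef _ _ _ _ _ (weight_posSemidef hW hU hT hη _) hU hη

lemma estLoss_nonneg (hW : G.W.PosSemidef) (hU : G.U.PosDef) (hT : G.T.PosSemidef)
    (hη : 0 ≤ G.η) (ω : Sample nx ny) (k : ℕ) : 0 ≤ G.estLoss π ρ ω k :=
  add_nonneg (G.spread_nonneg hW _) (mul_nonneg (ind_nonneg _)
    (G.gapSpread_nonneg (estWeight_posSemidef hW hU hT hη k) _))

/-- The mean of a quadratic form at the state. -/
lemma lintegral_quad_play (hQ : G.Q.PosDef) (hR : G.R.PosDef) (hP : G.IsSteadyState)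
    {M : Matrix (Fin nx) (Fin nx) ℝ} (hM : M.PosSemidef) (k : ℕ) :
    ∫⁻ ω, ENNReal.ofReal (quad M (G.play π ρ ω k).x) ∂G.law
      = ∫⁻ ω, ENNReal.ofReal (quad M (G.play π ρ ω k).xbar + G.spread M (G.play π ρ ω k).τ)
          ∂G.law := by
  have h := G.lintegral_hist_errors π ρ hQ hR hP k
    (Φ := fun y => ENNReal.ofReal (quad M (y.1.1 + y.2.1 + y.2.2))) (by fun_prop)
  simp only [G.lintegral_quad_state hM] at h
  refine Eq.trans ?_ h
  refine lintegral_congr fun ω => ?_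
  congr 2
  simp only [Snapshot.hist, errors]
  abel

/-- The mean of a quadratic form at the estimate. -/
lemma lintegral_quad_xhat (hQ : G.Q.PosDef) (hR : G.R.PosDef) (hP : G.IsSteadyState)
    {M : Matrix (Fin nx) (Fin nx) ℝ} (hM : M.PosSemidef) (k : ℕ) :
    ∫⁻ ω, ENNReal.ofReal (quad M (G.outcome π ρ ω k).xhat) ∂G.law
      = ∫⁻ ω, ENNReal.ofReal (quad M (G.play π ρ ω k).xbar
          + ind (G.outcome π ρ ω k).γ * G.gapSpread M (G.play π ρ ω k).τ) ∂G.law := by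
  have hack : Measurable fun y : Hist nx nu k × (Vec nx × Vec nx) × Seeds =>
      G.histAck π ρ y.1 y.2.2 := G.measurable_histAck π ρ (by fun_prop) (by fun_prop)
  have hx : Measurable fun y : Hist nx nu k × (Vec nx × Vec nx) × Seeds =>
      if G.histAck π ρ y.1 y.2.2 then y.1.1 + y.2.1.1 else y.1.1 :=
    measurable_ite_bool hack (by fun_prop) (by fun_prop)
  have hg : Measurable fun y : Hist nx nu k × (Vec nx × Vec nx) × Seeds =>
      G.gapSpread M y.1.2.1 :=
    (measurable_of_countable (G.gapSpread M)).comp measurable_fst.snd.fst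
  have h1 := G.lintegral_hist_errors_seeds π ρ hQ hR hP k
    (F := fun y => ENNReal.ofReal (quad M (if G.histAck π ρ y.1 y.2.2 then y.1.1 + y.2.1.1
      else y.1.1))) (by fun_prop)
  have h2 := G.lintegral_hist_errors_seeds π ρ hQ hR hP k
    (F := fun y => ENNReal.ofReal (quad M y.1.1
      + ind (G.histAck π ρ y.1 y.2.2) * G.gapSpread M y.1.2.1)) (by fun_prop)
  have hL : ∀ ω : Sample nx ny, (G.outcome π ρ ω k).xhat
      = if G.histAck π ρ (G.play π ρ ω k).hist (ω.2 k).2.2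
        then (G.play π ρ ω k).hist.1 + (G.errors (G.play π ρ ω k) (ω.2 k).2.1).1
        else (G.play π ρ ω k).hist.1 := fun ω => by
    rw [outcome_eq]
    exact G.stage_xhat _ _ _ _ _ _
  simp only [hL]
  rw [h1]
  refine Eq.trans ?_ h2.symm
  refine lintegral_congr fun ω => ?_
  rw [lintegral_lintegral_swap]
  · simp only [lintegral_const, measure_univ, mul_one]
    exact lintegral_congr fun θ => G.lintegral_quad_estimate hM _ _ _
  · have hω : Measurable fun y : (Vec nx × Vec nx) × Seeds =>
      ((G.play π ρ ω k).hist, y.1, y.2) := by fun_prop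
    exact ((measurable_quad M).comp (hx.comp hω)).ennreal_ofReal.aemeasurable

/-- One step of the quadratic cost: the Riccati weights turn the stage cost into the loss due to
the estimation errors and the deviation cost of the input. -/
lemma lintegral_stage (hQ : G.Q.PosDef) (hR : G.R.PosDef) (hP : G.IsSteadyState)
    (hW : G.W.PosSemidef) (hU : G.U.PosDef) (hT : G.T.PosSemidef) (hη : 0 ≤ G.η) {k : ℕ}
    (hk : k ≤ G.K) :
    ∫⁻ ω, ENNReal.ofReal (quad G.W (G.play π ρ ω k).x + quad G.U (G.outcome π ρ ω k).u) ∂G.law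
      + ENNReal.ofReal G.η * ∫⁻ ω, ENNReal.ofReal
          (quad (G.weight (G.K + 1 - (k + 1))) (G.play π ρ ω (k + 1)).xbar) ∂G.law
      = ∫⁻ ω, ENNReal.ofReal (quad (G.weight (G.K + 1 - k)) (G.play π ρ ω k).xbar) ∂G.law
        + (∫⁻ ω, ENNReal.ofReal (G.estLoss π ρ ω k) ∂G.law
          + ∫⁻ ω, ENNReal.ofReal (G.devLoss π ρ ω k) ∂G.law) := by
  have hS := weight_posSemidef hW hU hT hη (G.K - k)
  have hZ := estWeight_posSemidef hW hU hT hη k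
  have hx := (G.measurable_play π ρ k).1
  have hxbar := G.measurable_xbar π ρ k
  have hxbar' := G.measurable_xbar π ρ (k + 1)
  have hxhat := G.measurable_outcome_xhat π ρ k
  have hu := G.measurable_outcome_u π ρ k
  have hdev := G.measurable_devLoss π ρ k
  have hest := G.measurable_estLoss π ρ k
  have hτ : ∀ g : ℕ → ℝ, Measurable fun ω : Sample nx ny => g (G.play π ρ ω k).τ := fun g =>
    (measurable_of_countable g).comp (G.measurable_hold π ρ k)
  have hτ₁ := hτ (G.spread G.W)
  have hτ₂ := hτ (G.gapSpread (G.estWeight k))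
  have hγ := G.measurable_outcome_γ π ρ k
  have hdev0 : ∀ ω, 0 ≤ G.devLoss π ρ ω k := fun ω => G.deviation_nonneg hS hU hη _
  have hpt : ∀ ω : Sample nx ny,
      quad G.W (G.play π ρ ω k).x + quad G.U (G.outcome π ρ ω k).u
        + G.η * quad (G.weight (G.K - k)) (G.play π ρ ω (k + 1)).xbar
      = quad G.W (G.play π ρ ω k).x + quad (G.estWeight k) (G.outcome π ρ ω k).xhat
        + G.devLoss π ρ ω k := fun ω => by
    have h := complete_square G.A (G.weight (G.K - k)) G.B G.U G.η hS hU hη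
      (G.outcome π ρ ω k).xhat (G.outcome π ρ ω k).u
    have h' : (G.play π ρ ω (k + 1)).xbar
        = act G.A (G.outcome π ρ ω k).xhat + act G.B (G.outcome π ρ ω k).u := rfl
    rw [h', devLoss, deviation, estWeight]
    linarith
  have hpt' : ∀ ω : Sample nx ny,
      ENNReal.ofReal (quad G.W (G.play π ρ ω k).xbar + G.spread G.W (G.play π ρ ω k).τ)
        + ENNReal.ofReal (quad (G.estWeight k) (G.play π ρ ω k).xbar
          + ind (G.outcome π ρ ω k).γ * G.gapSpread (G.estWeight k) (G.play π ρ ω k).τ)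
      = ENNReal.ofReal (quad (G.weight (G.K + 1 - k)) (G.play π ρ ω k).xbar)
        + ENNReal.ofReal (G.estLoss π ρ ω k) := fun ω => by
    rw [← ENNReal.ofReal_add (add_nonneg (quad_nonneg hW _) (G.spread_nonneg hW _))
      (add_nonneg (quad_nonneg hZ _) (mul_nonneg (ind_nonneg _) (G.gapSpread_nonneg hZ _))),
      ← ENNReal.ofReal_add (quad_nonneg (weight_posSemidef hW hU hT hη _) _)
        (estLoss_nonneg π ρ hW hU hT hη ω k), Nat.succ_sub hk, weight_succ, quad_matrix_add,
      estLoss, estWeight]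
    congr 1
    ring
  rw [Nat.add_sub_add_right, ← lintegral_const_mul _ (by fun_prop),
    ← lintegral_add_right _ (by fun_prop), ← add_assoc, ← lintegral_add_right _ (by fun_prop)]
  simp_rw [← hpt', ← ENNReal.ofReal_mul hη]
  have hc : ∀ ω : Sample nx ny,
      ENNReal.ofReal (quad G.W (G.play π ρ ω k).x + quad G.U (G.outcome π ρ ω k).u)
        + ENNReal.ofReal (G.η * quad (G.weight (G.K - k)) (G.play π ρ ω (k + 1)).xbar)
      = ENNReal.ofReal (quad G.W (G.play π ρ ω k).x)
        + ENNReal.ofReal (quad (G.estWeight k) (G.outcome π ρ ω k).xhat)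
        + ENNReal.ofReal (G.devLoss π ρ ω k) := fun ω => by
    rw [← ENNReal.ofReal_add (add_nonneg (quad_nonneg hW _) (quad_nonneg hU.posSemidef _))
      (mul_nonneg hη (quad_nonneg hS _)), hpt,
      ENNReal.ofReal_add (add_nonneg (quad_nonneg hW _) (quad_nonneg hZ _)) (hdev0 ω),
      ENNReal.ofReal_add (quad_nonneg hW _) (quad_nonneg hZ _)]
  simp_rw [hc]
  rw [lintegral_add_right _ (by fun_prop), lintegral_add_right _ (by fun_prop),
    lintegral_add_right _ (by fun_prop), lintegral_quad_play π ρ hQ hR hP hW,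
    lintegral_quad_xhat π ρ hQ hR hP hZ]

/-- The quadratic cost of the first `n` stages plus the quadratic cost-to-go. -/
lemma sum_lintegral_stage (hQ : G.Q.PosDef) (hR : G.R.PosDef) (hP : G.IsSteadyState)
    (hW : G.W.PosSemidef) (hU : G.U.PosDef) (hT : G.T.PosSemidef) (hη : 0 ≤ G.η) (n : ℕ)
    (hn : n ≤ G.K + 1) :
    ∑ k ∈ Finset.range n, ENNReal.ofReal G.η ^ k * ∫⁻ ω, ENNReal.ofReal
        (quad G.W (G.play π ρ ω k).x + quad G.U (G.outcome π ρ ω k).u) ∂G.law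
      + ENNReal.ofReal G.η ^ n * ∫⁻ ω, ENNReal.ofReal
          (quad (G.weight (G.K + 1 - n)) (G.play π ρ ω n).xbar) ∂G.law
      = ∑ k ∈ Finset.range n, ENNReal.ofReal G.η ^ k *
          (∫⁻ ω, ENNReal.ofReal (G.estLoss π ρ ω k) ∂G.law
          + ∫⁻ ω, ENNReal.ofReal (G.devLoss π ρ ω k) ∂G.law) := by
  induction n with
  | zero =>
    have h : ∀ ω : Sample nx ny, (G.play π ρ ω 0).xbar = 0 := fun ω => rfl
    simp [h, quad_zero]
  | succ n ih =>
    rw [Finset.sum_range_succ, Finset.sum_range_succ, ← ih (by omega), add_assoc, pow_succ,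
      mul_assoc, ← mul_add, lintegral_stage π ρ hQ hR hP hW hU hT hη (by omega), mul_add, add_assoc]

lemma holdCost_eq (ω : Sample nx ny) : G.holdCost π ρ ω
    = (G.K : ℝ)⁻¹ * (∑ k ∈ Finset.range (G.K + 1), G.η ^ k * G.estLoss π ρ ω k
        + G.η ^ (G.K + 1) * G.spread G.T (G.play π ρ ω (G.K + 1)).τ)
      + (G.K : ℝ)⁻¹ * ∑ k ∈ Finset.range (G.K + 1), G.η ^ k *
        (G.cs * ind (G.outcome π ρ ω k).ν - G.ca * ind (G.outcome π ρ ω k).a) := by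
  simp only [holdCost, holdLoss, mul_add, Finset.sum_add_distrib]
  ring

/-- The expected cost is a finite part, governed by the scheduling strategies, plus the deviation
cost of the inputs from the linear law. -/
theorem J_eq (hQ : G.Q.PosDef) (hR : G.R.PosDef) (hP : G.IsSteadyState)
    (hW : G.W.PosSemidef) (hU : G.U.PosDef) (hT : G.T.PosSemidef) (hη : 0 ≤ G.η) :
    G.J π ρ = ((∫ ω, G.holdCost π ρ ω ∂G.law : ℝ) : EReal) + (G.excess π ρ : EReal) := by
  have hK : (0 : ℝ) ≤ (G.K : ℝ)⁻¹ := by positivity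
  have hquad : ∀ k, Measurable fun ω : Sample nx ny =>
      quad G.W (G.play π ρ ω k).x + quad G.U (G.outcome π ρ ω k).u := fun k => by
    have h1 := (G.measurable_play π ρ k).1
    have h2 := G.measurable_outcome_u π ρ k
    fun_prop
  have hquad0 : ∀ (ω : Sample nx ny) (k : ℕ),
      0 ≤ quad G.W (G.play π ρ ω k).x + quad G.U (G.outcome π ρ ω k).u := fun ω k =>
    add_nonneg (quad_nonneg hW _) (quad_nonneg hU.posSemidef _)
  have hterm : Measurable fun ω : Sample nx ny => quad G.T (G.play π ρ ω (G.K + 1)).x := by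
    have h1 := (G.measurable_play π ρ (G.K + 1)).1
    fun_prop
  have hspr : Measurable fun ω : Sample nx ny => G.spread G.T (G.play π ρ ω (G.K + 1)).τ :=
    (measurable_of_countable (G.spread G.T)).comp (G.measurable_hold π ρ _)
  have hest0 := estLoss_nonneg π ρ hW hU hT hη
  have hsplit : ∀ ω : Sample nx ny, G.realizedCost π ρ ω
      = (G.K : ℝ)⁻¹ * (∑ k ∈ Finset.range (G.K + 1), G.η ^ k *
          (quad G.W (G.play π ρ ω k).x + quad G.U (G.outcome π ρ ω k).u)
        + G.η ^ (G.K + 1) * quad G.T (G.play π ρ ω (G.K + 1)).x)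
        + (G.K : ℝ)⁻¹ * ∑ k ∈ Finset.range (G.K + 1), G.η ^ k *
        (G.cs * ind (G.outcome π ρ ω k).ν - G.ca * ind (G.outcome π ρ ω k).a) := fun ω => by
    have h : ∀ k, G.cost (G.play π ρ ω k).x (G.snapOutcome π ρ (G.play π ρ ω k) (ω.2 k))
        = (quad G.W (G.play π ρ ω k).x + quad G.U (G.outcome π ρ ω k).u)
          + (G.cs * ind (G.outcome π ρ ω k).ν - G.ca * ind (G.outcome π ρ ω k).a) := fun k => by
      change quad G.W (G.play π ρ ω k).x + quad G.U (G.outcome π ρ ω k).u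
        + G.cs * ind (G.outcome π ρ ω k).ν - G.ca * ind (G.outcome π ρ ω k).a = _
      ring
    simp only [realizedCost, h, mul_add, Finset.sum_add_distrib]
    ring
  have hprices : Integrable (fun ω : Sample nx ny => (G.K : ℝ)⁻¹ *
      ∑ k ∈ Finset.range (G.K + 1), G.η ^ k *
        (G.cs * ind (G.outcome π ρ ω k).ν - G.ca * ind (G.outcome π ρ ω k).a)) G.law :=
    (integrable_finsetSum _ fun k _ => (G.integrable_prices π ρ k).const_mul _).const_mul _
  have hest : Integrable (fun ω : Sample nx ny => (G.K : ℝ)⁻¹ *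
      (∑ k ∈ Finset.range (G.K + 1), G.η ^ k * G.estLoss π ρ ω k
        + G.η ^ (G.K + 1) * G.spread G.T (G.play π ρ ω (G.K + 1)).τ)) G.law :=
    ((integrable_finsetSum _ fun k _ => (G.integrable_estLoss π ρ k).const_mul _).add
      ((G.integrable_hold π ρ _ _).const_mul _)).const_mul _
  have hnn : ∀ ω : Sample nx ny, 0 ≤ (G.K : ℝ)⁻¹ *
      (∑ k ∈ Finset.range (G.K + 1), G.η ^ k * G.estLoss π ρ ω k
        + G.η ^ (G.K + 1) * G.spread G.T (G.play π ρ ω (G.K + 1)).τ) := fun ω =>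
    mul_nonneg hK (add_nonneg (Finset.sum_nonneg fun k _ =>
      mul_nonneg (pow_nonneg hη k) (hest0 ω k))
      (mul_nonneg (pow_nonneg hη _) (G.spread_nonneg hT _)))
  have hterm_eq : ∫⁻ ω, ENNReal.ofReal (quad G.T (G.play π ρ ω (G.K + 1)).x) ∂G.law
      = ∫⁻ ω, ENNReal.ofReal (quad G.T (G.play π ρ ω (G.K + 1)).xbar) ∂G.law
        + ∫⁻ ω, ENNReal.ofReal (G.spread G.T (G.play π ρ ω (G.K + 1)).τ) ∂G.law := by
    rw [lintegral_quad_play π ρ hQ hR hP hT, ← lintegral_add_right _ hspr.ennreal_ofReal]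
    exact lintegral_congr fun ω => ENNReal.ofReal_add (quad_nonneg hT _) (G.spread_nonneg hT _)
  -- the quadratic cost is the loss due to the estimation errors plus the deviation cost
  have hmain : ∫⁻ ω, ENNReal.ofReal ((G.K : ℝ)⁻¹ * (∑ k ∈ Finset.range (G.K + 1), G.η ^ k *
          (quad G.W (G.play π ρ ω k).x + quad G.U (G.outcome π ρ ω k).u)
        + G.η ^ (G.K + 1) * quad G.T (G.play π ρ ω (G.K + 1)).x)) ∂G.law
      = ∫⁻ ω, ENNReal.ofReal ((G.K : ℝ)⁻¹ *
          (∑ k ∈ Finset.range (G.K + 1), G.η ^ k * G.estLoss π ρ ω k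
            + G.η ^ (G.K + 1) * G.spread G.T (G.play π ρ ω (G.K + 1)).τ)) ∂G.law
        + G.excess π ρ := by
    have hS := sum_lintegral_stage π ρ hQ hR hP hW hU hT hη (G.K + 1) le_rfl
    rw [Nat.sub_self, show G.weight 0 = G.T from rfl] at hS
    have hex : G.excess π ρ = ∫⁻ ω, ENNReal.ofReal ((G.K : ℝ)⁻¹ * (∑ k ∈ Finset.range (G.K + 1),
        G.η ^ k * G.devLoss π ρ ω k + G.η ^ (G.K + 1) * 0)) ∂G.law := by
      simp only [excess, mul_zero, add_zero]
    rw [hex, lintegral_discounted G.law hK hη _ hquad (fun ω k _ => hquad0 ω k)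
        (fun ω => quad_nonneg hT _) hterm,
      lintegral_discounted G.law hK hη _ (G.measurable_estLoss π ρ) (fun ω k _ => hest0 ω k)
        (fun ω => G.spread_nonneg hT _) hspr,
      lintegral_discounted G.law hK hη (G.K + 1) (t := fun _ => 0) (G.measurable_devLoss π ρ)
        (fun ω k _ => G.deviation_nonneg (weight_posSemidef hW hU hT hη _) hU hη _)
        (fun _ => le_rfl) measurable_const, hterm_eq, mul_add (ENNReal.ofReal G.η ^ (G.K + 1)),
      ← add_assoc, hS]
    simp only [mul_add, Finset.sum_add_distrib, ENNReal.ofReal_zero, lintegral_zero, mul_zero,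
      add_zero]
    ring
  have hJ := eexp_coe_add (μ := G.law) (g := fun ω => (G.K : ℝ)⁻¹ *
      (∑ k ∈ Finset.range (G.K + 1), G.η ^ k *
          (quad G.W (G.play π ρ ω k).x + quad G.U (G.outcome π ρ ω k).u)
        + G.η ^ (G.K + 1) * quad G.T (G.play π ρ ω (G.K + 1)).x)) (measurable_const.mul
    ((Finset.measurable_fun_sum _ fun k _ => (hquad k).const_mul _).add (hterm.const_mul _)))
    (fun ω => mul_nonneg hK (add_nonneg (Finset.sum_nonneg fun k _ =>
      mul_nonneg (pow_nonneg hη k) (hquad0 ω k)) (mul_nonneg (pow_nonneg hη _)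
      (quad_nonneg hT _)))) hprices
  rw [J]
  simp_rw [hsplit]
  rw [show eexp G.law _ = _ from hJ, hmain, EReal.coe_ennreal_add,
    ← ofReal_integral_eq_lintegral_ofReal hest (ae_of_all _ hnn), EReal.coe_ennreal_ofReal,
    max_eq_left (integral_nonneg hnn), add_right_comm, ← EReal.coe_add,
    ← integral_add hest hprices]
  simp only [holdCost_eq]

end Model

namespace Model

variable {nx nu ny : ℕ} (G : Model nx nu ny) (π : Controller nx nu) (ρ : Attacker)

/-! ### The scheduling game -/

/-- The probability of a transmission at stage `k` of the play. -/
def transmitProb (ω : Sample nx ny) (k : ℕ) : I :=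
  π.sched k (G.play π ρ ω k).crec (G.play π ρ ω k).xbar (G.play π ρ ω k).τ

/-- The probability of an attack at stage `k` of the play. -/
def attackProb (ω : Sample nx ny) (k : ℕ) : I :=
  ρ.prob k (G.play π ρ ω k).arec (G.play π ρ ω k).τ

lemma integral_noise_seeds (Φ : Seeds → ℝ) : ∫ n, Φ n.2.2 ∂G.noiseLaw = ∫ θ, Φ θ := by
  rw [noiseLaw, integral_fun_snd (fun z : Vec ny × Seeds => Φ z.2), integral_fun_snd]
  simp

/-- The mean of the loss of stage `k` plus a function of the next holding time is the mean of the
bilinear payoff at the current probabilities. -/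
lemma integral_holdLoss_add (g : ℕ → ℝ) (k : ℕ) :
    ∫ ω, (G.holdLoss π ρ ω k + G.η * g (G.play π ρ ω (k + 1)).τ) ∂G.law
      = ∫ ω, G.payoff (G.weight (G.K - k)) g (G.play π ρ ω k).τ (G.transmitProb π ρ ω k)
          (G.attackProb π ρ ω k) ∂G.law := by
  rw [G.integral_fresh_noise k
    (Φ := fun ω => G.holdLoss π ρ ω k + G.η * g (G.play π ρ ω (k + 1)).τ)
    ((G.integrable_holdLoss π ρ k).add ((G.integrable_hold π ρ g (k + 1)).const_mul _))]
  refine integral_congr_ae (ae_of_all _ fun ω => ?_)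
  set τ := (G.play π ρ ω k).τ with hτ
  set p := G.transmitProb π ρ ω k with hp
  set q := G.attackProb π ρ ω k with hq
  have h : ∀ n : Noise nx ny, G.holdLoss π ρ (resample k (ω, n)) k
      + G.η * g (G.play π ρ (resample k (ω, n)) (k + 1)).τ
      = (G.spread G.W τ + G.η * g (τ + 1))
        + (G.gapSpread (G.estWeight k) τ + G.η * (g 0 - g (τ + 1))) * ind (G.ack p q n.2.2)
        + G.cs * ind (decide (n.2.2.1 < p)) - G.ca * ind (decide (n.2.2.2.1 < q)) := fun n => by
    have hnext : (G.play π ρ (resample k (ω, n)) (k + 1)).τ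
        = nextHold (G.play π ρ (resample k (ω, n)) k).τ (G.outcome π ρ (resample k (ω, n)) k) := rfl
    have hout : G.outcome π ρ (resample k (ω, n)) k = G.snapOutcome π ρ (G.play π ρ ω k) n := by
      rw [outcome, noise_resample]
      congr 1
      exact G.play_resample π ρ k (ω, n)
    rw [hnext, nextHold_eq _ g, holdLoss, estLoss, hout, G.play_resample π ρ k (ω, n)]
    change G.spread G.W τ + ind (G.ack p q n.2.2) * G.gapSpread (G.estWeight k) τ
      + (G.cs * ind (decide (n.2.2.1 < p)) - G.ca * ind (decide (n.2.2.2.1 < q)))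
      + G.η * (ind (G.ack p q n.2.2) * g 0 + (1 - ind (G.ack p q n.2.2)) * g (τ + 1)) = _
    ring
  simp only [h]
  rw [G.integral_noise_seeds fun θ => (G.spread G.W τ + G.η * g (τ + 1))
        + (G.gapSpread (G.estWeight k) τ + G.η * (g 0 - g (τ + 1))) * ind (G.ack p q θ)
        + G.cs * ind (decide (θ.1 < p)) - G.ca * ind (decide (θ.2.1 < q)),
    (G.integral_coins _ _ _ _ p q).2, payoff, estWeight]
  ring

lemma integral_holdCost : ∫ ω, G.holdCost π ρ ω ∂G.law
    = (G.K : ℝ)⁻¹ * (∑ k ∈ Finset.range (G.K + 1), G.η ^ k * ∫ ω, G.holdLoss π ρ ω k ∂G.law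
      + G.η ^ (G.K + 1) * ∫ ω, G.dpValue (G.K + 1 - (G.K + 1)) (G.play π ρ ω (G.K + 1)).τ
          ∂G.law) := by
  simp only [holdCost]
  rw [integral_const_mul, integral_add
    (integrable_finsetSum _ fun k _ => (G.integrable_holdLoss π ρ k).const_mul _)
    ((G.integrable_hold π ρ _ _).const_mul _), integral_const_mul,
    integral_finsetSum _ fun k _ => (G.integrable_holdLoss π ρ k).const_mul _, Nat.sub_self]
  simp only [integral_const_mul]
  rfl

lemma integral_dpValue_zero : ∫ ω, G.dpValue (G.K + 1) (G.play π ρ ω 0).τ ∂G.law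
    = G.dpValue (G.K + 1) 0 := by
  have h : ∀ ω : Sample nx ny, (G.play π ρ ω 0).τ = 0 := fun ω => rfl
  simp [h]

/-- One step of the dynamic-programming recursion along the play. -/
lemma integral_holdLoss_add_dpValue (k : ℕ) :
    ∫ ω, G.holdLoss π ρ ω k ∂G.law
      + G.η * ∫ ω, G.dpValue (G.K - k) (G.play π ρ ω (k + 1)).τ ∂G.law
      = ∫ ω, G.payoff (G.weight (G.K - k)) (G.dpValue (G.K - k)) (G.play π ρ ω k).τ
          (G.transmitProb π ρ ω k) (G.attackProb π ρ ω k) ∂G.law := by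
  rw [← integral_holdLoss_add, integral_add (G.integrable_holdLoss π ρ k)
    ((G.integrable_hold π ρ _ (k + 1)).const_mul _), integral_const_mul]

lemma integrable_payoff (g : ℕ → ℝ) (k : ℕ) :
    Integrable (fun ω => G.payoff (G.weight (G.K - k)) g (G.play π ρ ω k).τ
      (G.transmitProb π ρ ω k) (G.attackProb π ρ ω k)) G.law := by
  have hp : Measurable fun ω : Sample nx ny => (G.transmitProb π ρ ω k : ℝ) :=
    measurable_subtype_coe.comp (measurable_sched π (G.measurable_hist π ρ k))
  have hq : Measurable fun ω : Sample nx ny => (G.attackProb π ρ ω k : ℝ) :=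
    measurable_subtype_coe.comp (measurable_prob ρ (G.measurable_hist π ρ k))
  have bdd : ∀ t : I, ‖(t : ℝ)‖ ≤ 1 := fun t => by rw [Real.norm_of_nonneg t.2.1]; exact t.2.2
  have hpi : Integrable (fun ω : Sample nx ny => (G.transmitProb π ρ ω k : ℝ)) G.law :=
    Integrable.of_bound hp.aestronglyMeasurable 1 (ae_of_all _ fun ω => bdd _)
  have hqi : Integrable (fun ω : Sample nx ny => (G.attackProb π ρ ω k : ℝ)) G.law :=
    Integrable.of_bound hq.aestronglyMeasurable 1 (ae_of_all _ fun ω => bdd _)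
  have hX := G.integrable_hold π ρ (fun τ => G.gapSpread (G.estWeight k) τ
    + G.η * (g 0 - g (τ + 1))) k
  have h1 := hX.bdd_mul (c := 1) hp.aestronglyMeasurable (ae_of_all _ fun ω => bdd _)
  have h2 := h1.bdd_mul (c := 1) hq.aestronglyMeasurable (ae_of_all _ fun ω => bdd _)
  have h0 := G.integrable_hold π ρ (fun τ => G.spread G.W τ + G.η * g (τ + 1)) k
  refine ((((h0.add (h1.const_mul G.lam)).add (h2.const_mul (G.lamA - G.lam))).add
    (hpi.const_mul G.cs)).sub (hqi.const_mul G.ca)).congr (ae_of_all _ fun ω => ?_)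
  simp only [Pi.add_apply, Pi.sub_apply, payoff, arrival, estWeight]
  ring

/-- If the payoff of every stage is at least the dynamic-programming value, then so is the
total cost. -/
lemma le_integral_holdCost (hη : 0 ≤ G.η)
    (h : ∀ k ≤ G.K, ∀ ω, G.dpValue (G.K - k + 1) (G.play π ρ ω k).τ
      ≤ G.payoff (G.weight (G.K - k)) (G.dpValue (G.K - k)) (G.play π ρ ω k).τ
        (G.transmitProb π ρ ω k) (G.attackProb π ρ ω k)) :
    (G.K : ℝ)⁻¹ * G.dpValue (G.K + 1) 0 ≤ ∫ ω, G.holdCost π ρ ω ∂G.law := by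
  rw [integral_holdCost]
  refine mul_le_mul_of_nonneg_left ?_ (by positivity)
  have key : ∀ n ≤ G.K + 1, G.dpValue (G.K + 1) 0
      ≤ ∑ k ∈ Finset.range n, G.η ^ k * ∫ ω, G.holdLoss π ρ ω k ∂G.law
        + G.η ^ n * ∫ ω, G.dpValue (G.K + 1 - n) (G.play π ρ ω n).τ ∂G.law := fun n => by
    induction n with
    | zero => intro _; simp [integral_dpValue_zero]
    | succ n ih =>
      intro hn
      refine (ih (by omega)).trans ?_
      rw [Finset.sum_range_succ, add_assoc, pow_succ, mul_assoc, ← mul_add, Nat.add_sub_add_right,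
        integral_holdLoss_add_dpValue, Nat.succ_sub (by omega : n ≤ G.K)]
      have := integral_mono (G.integrable_hold π ρ _ n) (G.integrable_payoff π ρ _ n)
        (h n (by omega))
      gcongr
  exact key _ le_rfl

/-- If the payoff of every stage is at most the dynamic-programming value, then so is the
total cost. -/
lemma integral_holdCost_le (hη : 0 ≤ G.η)
    (h : ∀ k ≤ G.K, ∀ ω,
      G.payoff (G.weight (G.K - k)) (G.dpValue (G.K - k)) (G.play π ρ ω k).τ
        (G.transmitProb π ρ ω k) (G.attackProb π ρ ω k)
      ≤ G.dpValue (G.K - k + 1) (G.play π ρ ω k).τ) :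
    ∫ ω, G.holdCost π ρ ω ∂G.law ≤ (G.K : ℝ)⁻¹ * G.dpValue (G.K + 1) 0 := by
  rw [integral_holdCost]
  refine mul_le_mul_of_nonneg_left ?_ (by positivity)
  have key : ∀ n ≤ G.K + 1, ∑ k ∈ Finset.range n, G.η ^ k * ∫ ω, G.holdLoss π ρ ω k ∂G.law
        + G.η ^ n * ∫ ω, G.dpValue (G.K + 1 - n) (G.play π ρ ω n).τ ∂G.law
      ≤ G.dpValue (G.K + 1) 0 := fun n => by
    induction n with
    | zero => intro _; simp [integral_dpValue_zero]
    | succ n ih =>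
      intro hn
      refine le_trans ?_ (ih (by omega))
      rw [Finset.sum_range_succ, add_assoc, pow_succ, mul_assoc, ← mul_add, Nat.add_sub_add_right,
        integral_holdLoss_add_dpValue, Nat.succ_sub (by omega : n ≤ G.K)]
      have := integral_mono (G.integrable_payoff π ρ _ n) (G.integrable_hold π ρ _ n)
        (h n (by omega))
      gcongr
  exact key _ le_rfl

/-- With the linear inputs there is no deviation cost. -/
lemma excess_markov (r : ℕ → ℕ → I) : G.excess (markovController r G.gain) ρ = 0 := by
  have h : ∀ (ω : Sample nx ny) (k : ℕ), G.devLoss (markovController r G.gain) ρ ω k = 0 :=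
    fun ω k => G.deviation_eq_zero _ rfl
  simp [excess, h]

/-- When the scheduling rule depends on the holding time only, the holding times and the
attacker's records, and thus the scheduling cost, do not depend on the control law. -/
lemma holdCost_congr {π π' : Controller nx nu} (r : ℕ → ℕ → I)
    (hπ : ∀ k h xbar τ, π.sched k h xbar τ = r k τ)
    (hπ' : ∀ k h xbar τ, π'.sched k h xbar τ = r k τ) (ω : Sample nx ny) :
    G.holdCost π ρ ω = G.holdCost π' ρ ω := by
  have step : ∀ k, (G.play π ρ ω k).τ = (G.play π' ρ ω k).τ →
      (G.play π ρ ω k).arec = (G.play π' ρ ω k).arec →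
      (G.outcome π ρ ω k).ν = (G.outcome π' ρ ω k).ν ∧
      (G.outcome π ρ ω k).a = (G.outcome π' ρ ω k).a ∧
      (G.outcome π ρ ω k).γ = (G.outcome π' ρ ω k).γ := fun k h1 h2 => by
    simp only [outcome, snapOutcome, stage_ν, stage_a, stage_γ, hπ, hπ', h1, h2, and_self]
  have hrec : ∀ k, (G.play π ρ ω k).τ = (G.play π' ρ ω k).τ ∧
      (G.play π ρ ω k).arec = (G.play π' ρ ω k).arec := fun k => by
    induction k with
    | zero => exact ⟨rfl, rfl⟩
    | succ k ih =>
      obtain ⟨-, ha, hγ⟩ := step k ih.1 ih.2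
      constructor
      · change nextHold (G.play π ρ ω k).τ (G.outcome π ρ ω k)
          = nextHold (G.play π' ρ ω k).τ (G.outcome π' ρ ω k)
        rw [nextHold, nextHold, hγ, ih.1]
      · change Fin.snoc (α := fun _ => ARec) (G.play π ρ ω k).arec
            ((G.play π ρ ω k).τ, (G.outcome π ρ ω k).a, (G.outcome π ρ ω k).γ)
          = Fin.snoc (α := fun _ => ARec) (G.play π' ρ ω k).arec
            ((G.play π' ρ ω k).τ, (G.outcome π' ρ ω k).a, (G.outcome π' ρ ω k).γ)
        rw [ih.1, ih.2, ha, hγ]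
  have hloss : ∀ k, G.holdLoss π ρ ω k = G.holdLoss π' ρ ω k := fun k => by
    obtain ⟨h1, h2, h3⟩ := step k (hrec k).1 (hrec k).2
    rw [holdLoss, holdLoss, estLoss, estLoss, h1, h2, h3, (hrec k).1]
  simp only [holdCost, hloss, (hrec _).1]

/-- The equilibrium transmission probability at stage `k` with holding time `τ`. -/
def eqTransmit (k τ : ℕ) : I := (G.saddle (G.weight (G.K - k)) (G.dpValue (G.K - k)) τ).1

/-- The equilibrium attack probability at stage `k` with holding time `τ`. -/
def eqAttack (k τ : ℕ) : I := (G.saddle (G.weight (G.K - k)) (G.dpValue (G.K - k)) τ).2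

lemma le_integral_holdCost_eqAttack (hη : 0 ≤ G.η) :
    (G.K : ℝ)⁻¹ * G.dpValue (G.K + 1) 0
      ≤ ∫ ω, G.holdCost π (markovAttacker G.eqAttack) ω ∂G.law :=
  G.le_integral_holdCost π _ hη fun _ _ _ => G.payoff_saddle_le _ _ _ _

lemma integral_holdCost_eqTransmit_le (hη : 0 ≤ G.η) (L : ℕ → Matrix (Fin nu) (Fin nx) ℝ) :
    ∫ ω, G.holdCost (markovController G.eqTransmit L) ρ ω ∂G.law
      ≤ (G.K : ℝ)⁻¹ * G.dpValue (G.K + 1) 0 :=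
  G.integral_holdCost_le _ ρ hη fun _ _ _ => G.payoff_saddle_ge _ _ _ _

end Model

end DoSGame

end

theorem theorem1 {nx nu ny : ℕ} (G : DoSGame.Model nx nu ny)
    (hQ : G.Q.PosDef) (hR : G.R.PosDef) (hP : G.IsSteadyState)
    (hW : G.W.PosSemidef) (hU : G.U.PosDef) (hT : G.T.PosSemidef)
    (hη0 : 0 < G.η) (hη1 : G.η < 1) (hlam : G.lamA < G.lam) (hK : 1 ≤ G.K) :
    -- Nash equilibrium: `ν_k` and `a_k` depend on `τ_{k-1}` only, and `u_k = L_k x̂_k`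
    (∃ p q : ℕ → ℕ → unitInterval,
      (∀ π : DoSGame.Controller nx nu,
        G.J (DoSGame.markovController p G.gain) (DoSGame.markovAttacker q)
          ≤ G.J π (DoSGame.markovAttacker q)) ∧
      (∀ ρ : DoSGame.Attacker,
        G.J (DoSGame.markovController p G.gain) ρ
          ≤ G.J (DoSGame.markovController p G.gain) (DoSGame.markovAttacker q)) ∧
      -- the game has a finite value, the common value of min-max and max-min
      (∃ v : ℝ, G.J (DoSGame.markovController p G.gain) (DoSGame.markovAttacker q) = (v : EReal) ∧
        (⨅ π : DoSGame.Controller nx nu, ⨆ ρ : DoSGame.Attacker, G.J π ρ) = (v : EReal) ∧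
        (⨆ ρ : DoSGame.Attacker, ⨅ π : DoSGame.Controller nx nu, G.J π ρ) = (v : EReal) ∧
        (v : EReal) = (((G.K : ℝ)⁻¹ : ℝ) : EReal) * G.Jc 0 0 0) ∧
      -- the dynamic-programming values coincide at every stage and every observation
      (∀ k ≤ G.K + 1, ∀ (xbar : DoSGame.Vec nx) (τ : ℕ),
        ∃ v : ℝ, G.Jc k xbar τ = (v : EReal) ∧ G.Ja k xbar τ = (v : EReal)) ∧
      -- and the equilibrium decisions are optimal at every stage and every observation
      (∀ k ≤ G.K, ∀ (xbar : DoSGame.Vec nx) (τ : ℕ),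
        (∀ q' : unitInterval,
          G.stageValue (G.Jc (k + 1)) (p k τ) (DoSGame.linearRule (G.gain k) xbar) q' xbar τ
            ≤ G.Jc k xbar τ) ∧
        (∀ (p' : unitInterval) (κ : DoSGame.CtrlRule nx nu),
          G.Ja k xbar τ ≤ G.stageValue (G.Ja (k + 1)) p' κ (q k τ) xbar τ))) ∧
    -- separation: whatever the scheduling rule based on the holding time and whatever the attack,
    -- the same feedback gains are optimal among all control laws
    (∀ (r : ℕ → ℕ → unitInterval) (ρ : DoSGame.Attacker) (π : DoSGame.Controller nx nu),
      (∀ k h xbar τ, π.sched k h xbar τ = r k τ) →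
        G.J (DoSGame.markovController r G.gain) ρ ≤ G.J π ρ) := by
  have hη := hη0.le
  have hJ := fun π ρ => DoSGame.Model.J_eq (G := G) π ρ hQ hR hP hW hU hT hη
  set v : ℝ := (G.K : ℝ)⁻¹ * G.dpValue (G.K + 1) 0 with hv
  have hlower : ∀ π : DoSGame.Controller nx nu,
      (v : EReal) ≤ G.J π (DoSGame.markovAttacker G.eqAttack) := fun π => by
    rw [hJ]
    exact le_add_of_le_of_nonneg
      (EReal.coe_le_coe_iff.2 (G.le_integral_holdCost_eqAttack π hη)) (EReal.coe_ennreal_nonneg _)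
  have hupper : ∀ ρ : DoSGame.Attacker,
      G.J (DoSGame.markovController G.eqTransmit G.gain) ρ ≤ (v : EReal) := fun ρ => by
    rw [hJ, G.excess_markov, EReal.coe_ennreal_zero, add_zero]
    exact EReal.coe_le_coe_iff.2 (G.integral_holdCost_eqTransmit_le ρ hη _)
  have hvalue : G.J (DoSGame.markovController G.eqTransmit G.gain)
      (DoSGame.markovAttacker G.eqAttack) = (v : EReal) := le_antisymm (hupper _) (hlower _)
  have hJc : ∀ k, G.Jc k = fun x τ => ((DoSGame.quad (G.weight (G.K + 1 - k)) x
      + G.dpValue (G.K + 1 - k) τ : ℝ) : EReal) := fun k =>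
    DoSGame.Model.minMax_eq hW hU hT hη _
  have hJa : ∀ k, G.Ja k = fun x τ => ((DoSGame.quad (G.weight (G.K + 1 - k)) x
      + G.dpValue (G.K + 1 - k) τ : ℝ) : EReal) := fun k =>
    DoSGame.Model.maxMin_eq hW hU hT hη _
  have hminmax : (⨆ ρ : DoSGame.Attacker, ⨅ π : DoSGame.Controller nx nu, G.J π ρ)
      ≤ ⨅ π : DoSGame.Controller nx nu, ⨆ ρ : DoSGame.Attacker, G.J π ρ :=
    iSup_iInf_le_iInf_iSup _
  have hinf : (⨅ π : DoSGame.Controller nx nu, ⨆ ρ : DoSGame.Attacker, G.J π ρ) ≤ (v : EReal) :=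
    iInf_le_of_le _ (iSup_le hupper)
  have hsup : (v : EReal) ≤ ⨆ ρ : DoSGame.Attacker, ⨅ π : DoSGame.Controller nx nu, G.J π ρ :=
    le_iSup_of_le _ (le_iInf hlower)
  refine ⟨⟨G.eqTransmit, G.eqAttack, fun π => hvalue.trans_le (hlower π),
    fun ρ => (hupper ρ).trans_eq hvalue.symm,
    ⟨v, hvalue, le_antisymm hinf (hsup.trans hminmax), le_antisymm (hminmax.trans hinf) hsup, ?_⟩,
    fun k _ x τ => ⟨_, by rw [hJc], by rw [hJa]⟩, fun k hk x τ => ⟨fun q' => ?_, fun p' κ => ?_⟩⟩,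
    fun r ρ π hπ => ?_⟩
  · rw [hJc, hv]
    simp [DoSGame.quad_zero]
  · rw [hJc, hJc, Nat.add_sub_add_right, Nat.succ_sub hk]
    exact DoSGame.Model.stageValue_saddle_le hW hU hT hη _ q' x τ
  · rw [hJa, hJa, Nat.add_sub_add_right, Nat.succ_sub hk]
    exact DoSGame.Model.le_stageValue_saddle hW hU hT hη _ p' κ x τ
  · rw [hJ, hJ, G.excess_markov, EReal.coe_ennreal_zero, add_zero,
      show (fun ω => G.holdCost (DoSGame.markovController r G.gain) ρ ω)
        = fun ω => G.holdCost π ρ ω from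
        funext (G.holdCost_congr ρ r (fun _ _ _ _ => rfl) hπ)]
    exact le_add_of_nonneg_right (EReal.coe_ennreal_nonneg _)
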